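/- **Setting.** Let $n_1,n_2\ge 1$, let $X\subseteq\mathbb{R}^{m_1}$, $Y\subseteq\mathbb{R}^{m_2}$ be closed and convex, and let $f_i$ ($1\le i\le n_1$), $g_j$ ($1\le j\le n_2$) be real functions on $\mathbb{R}^{m_1}\times\mathbb{R}^{m_2}$, convex in the first and concave in the second argument, with $U(x,y):=\sum_i f_i(x,y)=\sum_j g_j(x,y)$ for $x\in X$, $y\in Y$. A saddle point of $\varphi$ on $X\times Y$ is $(x^*,y^*)\in X\times Y$ with $\varphi(x^*,y)\le\varphi(x^*,y^*)\le\varphi(x,y^*)$ for all $x\in X,y\in Y$; the Nash equilibria are the saddle points of $U$ on $X\times Y$. $\partial_x$ (resp. $\partial_y$) denotes the subdifferential of the convex (resp. concave) partial function, $P_K$ the projection onto $K$. The agents form two subnetworks $\mathcal V_1,\mathcal V_2$ with $|\mathcal V_\ell|=n_\ell$. At each time $k=0,1,\dots$ there is a digraph on $\mathcal V_1\cup\mathcal V_2$ containing all self-loops, with weights $a_{ij}(k)\ge0$, positive exactly when $(j,i)$ is an arc. $\mathcal N_i^\ell(k)=\{j\in\mathcal V_\ell:(j,i)\text{ is an arc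 at time }k\}$ and $A_\ell(k)=(a_{ij}(k))_{i,j\in\mathcal V_\ell}$. **Algorithm.** From arbitrary $x_i(0)\in\mathbb{R}^{m_1}$, $y_i(0)\in\mathbb{R}^{m_2}$, with stepsizes $\alpha_{i,k},\beta_{i,k}>0$, $$x_i(k+1)=P_X\big(\hat x_i(k)-\alpha_{i,k}q_{1i}(k)\big),\quad q_{1i}(k)\in\partial_xf_i(\hat x_i(k),\breve x_i(k)),\quad i\in\mathcal V_1,$$ $$y_i(k+1)=P_Y\big(\hat y_i(k)+\beta_{i,k}q_{2i}(k)\big),\quad q_{2i}(k)\in\partial_yg_i(\breve y_i(k),\hat y_i(k)),\quad i\in\mathcal V_2,$$ where $\hat x_i(k)=\sum_{j\in\mathcal N_i^1(k)}a_{ij}(k)x_j(k)$, $\hat y_i(k)=\sum_{j\in\mathcal N_i^2(k)}a_{ij}(k)y_j(k)$, $\breve x_i(k)=\sum_{j\in\mathcal N_i^2(\breve k_i)}a_{ij}(\breve k_i)y_j(\breve k_i)$, $\breve y_i(k)=\sum_{j\in\mathcal N_i^1(\breve k_i)}a_{ij}(\breve k_i)x_j(\breve k_i)$, and, for $i\in\mathcal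 V_\ell$, $\breve k_i=\max\{s\le k:\mathcal N_i^{3-\ell}(s)\ne\emptyset\}$; at the initial times at which no such $s$ exists, $\breve x_i(k)$ (resp. $\breve y_i(k)$) is an arbitrary point. The network *achieves a Nash equilibrium* if for all initial states (and all choices of subgradients) there is a saddle point $(x^*,y^*)$ of $U$ on $X\times Y$ with $x_i(k)\to x^*$ for all $i\in\mathcal V_1$ and $y_i(k)\to y^*$ for all $i\in\mathcal V_2$. **Assumptions.** - A1: for each stochastic vector $\mu$, $\sum_i\mu_if_i$ has a saddle point on $X\times Y$. - A2: there is $T_{\bowtie}>0$ such that for every $k\ge0$ each agent of $\mathcal V_\ell$ ($\ell=1,2$) has at some time in $[k,k+T_{\bowtie})$ a neighbor in $\mathcal V_{3-\ell}$; and for $\ell=1,2$ there is $T_\ell>0$ such that for every $k\ge 0$ the union over the times in $[k,k+T_\ell)$ of the digraphs induced on $\mathcal V_\ell$ is strongly connected. - A3: there is $0<\eta<1$ with $a_{ij}(k)\ge\eta$ for every arc $(j,i)$ at time $k$; $\sum_{j\in\mathcal N_i^\ell(k)}a_{ij}(k)=1$ for all $k$ and $i\in\mathcal V_\ell$; and $\sum_{j\in\mathcal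 N_i^{3-\ell}(k)}a_{ij}(k)=1$ for $i\in\mathcal V_\ell$ whenever $\mathcal N_i^{3-\ell}(k)\neq\emptyset$. - A4: there is $L>0$ with $|q|\le L$ for all $x\in X$, $y\in Y$, all $i,j$ and all $q\in\partial_xf_i(x,y)\cup\partial_yg_j(x,y)$. **Theorem.** Suppose A1, A3, A4 hold and $U$ is strictly convex-concave on $X\times Y$ (for $y\in Y$, $U(\cdot,y)$ is strictly convex on $X$; for $x\in X$, $U(x,\cdot)$ is strictly concave on $Y$). Then for all time-varying communication graphs satisfying A2 (possibly weight-unbalanced) there exist stepsizes $\alpha_{i,k},\beta_{i,k}>0$ with which the network achieves a Nash equilibrium. Explicitly, with $\Phi^\ell(r,s)=A_\ell(r)A_\ell(r-1)\cdots A_\ell(s)$, for $\ell=1,2$ and every $s\ge0$ there is a positive stochastic vector $\phi^\ell(s)$ with $\lim_{r\to\infty}\Phi^\ell(r,s)=\mathbf 1\,\phi^\ell(s)'$ (so $\phi^\ell(s)$ is the Perron vector of this limit), and the network achieves a Nash equilibrium with $$\alpha_{i,k}=\frac{\gamma_k}{\phi^1_i(k+1)},\qquad \beta_{i,k}=\frac{\gamma_k}{\phi^2_i(k+1)}$$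 for every positive non-increasing sequence $\{\gamma_k\}$ with $\lim_{k\to\infty}\gamma_k\sum_{s=0}^{k-1}\gamma_s=0$, $\sum_k\gamma_k=\infty$ and $\sum_k\gamma_k^2<\infty$. -/

import Mathlib

open Filter Topology

/-- The Euclidean space `ℝ^m`. -/
abbrev RVec (m : ℕ) : Type := EuclideanSpace ℝ (Fin m)

/-! ### Convex analysis -/

/-- The subdifferential of a convex function on `ℝ^m` at `z`. -/
def convexSubdiff {m : ℕ} (φ : RVec m → ℝ) (z : RVec m) : Set (RVec m) :=
  {v | ∀ w, φ w ≥ φ z + inner ℝ (w - z) v}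

/-- The subdifferential of a concave function on `ℝ^m` at `z`. -/
def concaveSubdiff {m : ℕ} (φ : RVec m → ℝ) (z : RVec m) : Set (RVec m) :=
  {v | ∀ w, φ w ≤ φ z + inner ℝ (w - z) v}

/-- `p` is the projection `P_K(z)`: the point of `K` at minimal distance from `z`
(unique when `K` is closed and convex). -/
def IsProjection {m : ℕ} (K : Set (RVec m)) (z p : RVec m) : Prop :=
  p ∈ K ∧ ‖z - p‖ = Metric.infDist z K

/-- `φ` is convex in its first and concave in its second argument, on the whole space. -/
def ConvexConcave {m₁ m₂ : ℕ} (φ : RVec m₁ → RVec m₂ → ℝ) : Prop :=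
  (∀ y, ConvexOn ℝ Set.univ fun x => φ x y) ∧ (∀ x, ConcaveOn ℝ Set.univ fun y => φ x y)

/-- `φ` is strictly convex-concave on `X × Y`. -/
def StrictConvexConcaveOn {m₁ m₂ : ℕ} (X : Set (RVec m₁)) (Y : Set (RVec m₂))
    (φ : RVec m₁ → RVec m₂ → ℝ) : Prop :=
  (∀ y ∈ Y, StrictConvexOn ℝ X fun x => φ x y) ∧ (∀ x ∈ X, StrictConcaveOn ℝ Y fun y => φ x y)

/-- `(xs, ys)` is a saddle point of `φ` on `X × Y`. -/
def IsSaddlePoint {m₁ m₂ : ℕ} (X : Set (RVec m₁)) (Y : Set (RVec m₂))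
    (φ : RVec m₁ → RVec m₂ → ℝ) (xs : RVec m₁) (ys : RVec m₂) : Prop :=
  xs ∈ X ∧ ys ∈ Y ∧ ∀ x ∈ X, ∀ y ∈ Y, φ xs y ≤ φ xs ys ∧ φ xs ys ≤ φ x ys

/-! ### Time-varying communication networks -/

/-- A time-varying weighted digraph, with self-loops, on the agents `Fin n₁` of the first and
`Fin n₂` of the second subnetwork. `weight k i j` is the weight `a_{ij}(k) ≥ 0` of the arc `(j, i)`;
the arc is present at time `k` exactly when the weight is positive. -/
structure CommNetwork (n₁ n₂ : ℕ) where
  weight : ℕ → Matrix (Fin n₁ ⊕ Fin n₂) (Fin n₁ ⊕ Fin n₂) ℝ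
  weight_nonneg : ∀ k i j, 0 ≤ weight k i j
  self_loop : ∀ k i, 0 < weight k i i

/-- The digraph with arc set `⋃_{k₁ ≤ s < k₂} E(s)`. -/
def unionArc {V : Type*} (E : ℕ → V → V → Prop) (k₁ k₂ : ℕ) (u v : V) : Prop :=
  ∃ s, k₁ ≤ s ∧ s < k₂ ∧ E s u v

/-- Strong connectivity: there is a directed path from every node to every node. -/
def StronglyConnected {V : Type*} (R : V → V → Prop) : Prop :=
  ∀ u v, Relation.ReflTransGen R u v

/-- Uniformly jointly strongly connected digraph sequences. -/
def UJSC {V : Type*} (E : ℕ → V → V → Prop) : Prop :=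
  ∃ T : ℕ, 0 < T ∧ ∀ k, StronglyConnected (unionArc E k (k + T))

/-- `R` is bipartite with respect to the two subnetworks, and every node receives an arc from the
other subnetwork. -/
def BipartiteNoIsolated {V₁ V₂ : Type*} (R : V₁ ⊕ V₂ → V₁ ⊕ V₂ → Prop) : Prop :=
  (∀ u v, R u v → u.isLeft ≠ v.isLeft) ∧
  (∀ i : V₁, ∃ j : V₂, R (Sum.inr j) (Sum.inl i)) ∧
  (∀ i : V₂, ∃ j : V₁, R (Sum.inl j) (Sum.inr i))

/-- The transition matrix `Φ(r, s) = A(r) A(r-1) ⋯ A(s)` for `r ≥ s` (the identity for `r < s`). -/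
noncomputable def transition {n : ℕ} (A : ℕ → Matrix (Fin n) (Fin n) ℝ) :
    ℕ → ℕ → Matrix (Fin n) (Fin n) ℝ
  | 0, s => if s = 0 then A 0 else 1
  | r + 1, s => if s ≤ r + 1 then A (r + 1) * transition A r s else 1

/-- `v` is a positive stochastic vector with `lim_{r → ∞} Φ(r, s) = 𝟏 vᵀ`; in particular `v` is the
Perron vector of that limit. -/
def IsLimitVector {n : ℕ} (A : ℕ → Matrix (Fin n) (Fin n) ℝ) (s : ℕ) (v : Fin n → ℝ) : Prop :=
  (∀ i, 0 < v i) ∧ ∑ i, v i = 1 ∧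
  Tendsto (fun r => transition A r s) atTop (𝓝 (Matrix.vecMulVec 1 v))

namespace CommNetwork

variable {n₁ n₂ : ℕ} (N : CommNetwork n₁ n₂)

/-- `(j, i)` is an arc at time `k`, i.e. `j` is a neighbor of `i`. -/
def Arc (k : ℕ) (j i : Fin n₁ ⊕ Fin n₂) : Prop := 0 < N.weight k i j

/-- The adjacency matrix `A₁(k)` of the first subnetwork. -/
def A₁ (k : ℕ) : Matrix (Fin n₁) (Fin n₁) ℝ := (N.weight k).toBlocks₁₁

/-- The adjacency matrix `A₂(k)` of the second subnetwork. -/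
def A₂ (k : ℕ) : Matrix (Fin n₂) (Fin n₂) ℝ := (N.weight k).toBlocks₂₂

/-- The weights with which agents of the first subnetwork receive from the second one. -/
def C₁ (k : ℕ) : Matrix (Fin n₁) (Fin n₂) ℝ := (N.weight k).toBlocks₁₂

/-- The weights with which agents of the second subnetwork receive from the first one. -/
def C₂ (k : ℕ) : Matrix (Fin n₂) (Fin n₁) ℝ := (N.weight k).toBlocks₂₁

/-- The arcs of the first subnetwork. -/
def Arc₁ (k : ℕ) (j i : Fin n₁) : Prop := N.Arc k (Sum.inl j) (Sum.inl i)

/-- The arcs of the second subnetwork. -/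
def Arc₂ (k : ℕ) (j i : Fin n₂) : Prop := N.Arc k (Sum.inr j) (Sum.inr i)

/-- The arcs between the two subnetworks. -/
def interArc (k : ℕ) (j i : Fin n₁ ⊕ Fin n₂) : Prop := j.isLeft ≠ i.isLeft ∧ N.Arc k j i

/-- Agent `i` of the first subnetwork has a neighbor in the second one at time `k`. -/
def Contact₁ (k : ℕ) (i : Fin n₁) : Prop := ∃ j, N.Arc k (Sum.inr j) (Sum.inl i)

/-- Agent `i` of the second subnetwork has a neighbor in the first one at time `k`. -/
def Contact₂ (k : ℕ) (i : Fin n₂) : Prop := ∃ j, N.Arc k (Sum.inl j) (Sum.inr i)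

/-- Connectivity: the interconnection is uniformly jointly bipartite without isolated nodes, and
both subnetworks are uniformly jointly strongly connected. -/
def Connectivity : Prop :=
  (∃ T : ℕ, 0 < T ∧ ∀ k, BipartiteNoIsolated (unionArc N.interArc k (k + T))) ∧
  UJSC N.Arc₁ ∧ UJSC N.Arc₂

/-- Weight rule. Weights vanish off the arcs, so the sums over all agents of a subnetwork are sums
over neighbors. -/
def WeightRule : Prop :=
  (∃ η : ℝ, 0 < η ∧ η < 1 ∧ ∀ k i j, N.Arc k j i → η ≤ N.weight k i j) ∧
  ((∀ k i, ∑ j, N.A₁ k i j = 1) ∧ (∀ k i, ∑ j, N.A₂ k i j = 1)) ∧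
  ((∀ k i, N.Contact₁ k i → ∑ j, N.C₁ k i j = 1) ∧
    (∀ k i, N.Contact₂ k i → ∑ j, N.C₂ k i j = 1))

end CommNetwork

/-! ### The game, the algorithm and its convergence -/

/-- Existence of saddle points, for all weightings of the objectives by a stochastic vector. -/
def SaddleExistence {n₁ m₁ m₂ : ℕ} (X : Set (RVec m₁)) (Y : Set (RVec m₂))
    (f : Fin n₁ → RVec m₁ → RVec m₂ → ℝ) : Prop :=
  ∀ μ : Fin n₁ → ℝ, (∀ i, 0 ≤ μ i) → ∑ i, μ i = 1 →
    ∃ xs ys, IsSaddlePoint X Y (fun x y => ∑ i, μ i * f i x y) xs ys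

/-- Boundedness of subgradients on `X × Y`. -/
def BoundedSubgradients {n₁ n₂ m₁ m₂ : ℕ} (X : Set (RVec m₁)) (Y : Set (RVec m₂))
    (f : Fin n₁ → RVec m₁ → RVec m₂ → ℝ) (g : Fin n₂ → RVec m₁ → RVec m₂ → ℝ) : Prop :=
  ∃ L : ℝ, 0 < L ∧ ∀ x ∈ X, ∀ y ∈ Y,
    (∀ i, ∀ q ∈ convexSubdiff (fun x' => f i x' y) x, ‖q‖ ≤ L) ∧
    (∀ j, ∀ q ∈ concaveSubdiff (fun y' => g j x y') y, ‖q‖ ≤ L)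

/-- `x`, `y` are states generated by the algorithm with stepsizes `α k i`, `β k i`, from
the initial states `x 0`, `y 0`. Here `xb k i`, `yb k i` is the information that an agent holds about
the other subnetwork: the weighted average received at its last contact time `s ≤ k`; as long as the
agent has had no contact at all, it is an arbitrary point. -/
def IsTrajectory {n₁ n₂ m₁ m₂ : ℕ} (N : CommNetwork n₁ n₂)
    (X : Set (RVec m₁)) (Y : Set (RVec m₂))
    (f : Fin n₁ → RVec m₁ → RVec m₂ → ℝ) (g : Fin n₂ → RVec m₁ → RVec m₂ → ℝ)
    (α : ℕ → Fin n₁ → ℝ) (β : ℕ → Fin n₂ → ℝ)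
    (x : ℕ → Fin n₁ → RVec m₁) (y : ℕ → Fin n₂ → RVec m₂) : Prop :=
  ∃ (xb : ℕ → Fin n₁ → RVec m₂) (yb : ℕ → Fin n₂ → RVec m₁),
    (∀ k i s, IsGreatest {t | t ≤ k ∧ N.Contact₁ t i} s →
      xb k i = ∑ j, N.C₁ s i j • y s j) ∧
    (∀ k i s, IsGreatest {t | t ≤ k ∧ N.Contact₂ t i} s →
      yb k i = ∑ j, N.C₂ s i j • x s j) ∧
    (∀ k i, ∃ q ∈ convexSubdiff (fun x' => f i x' (xb k i)) (∑ j, N.A₁ k i j • x k j),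
      IsProjection X (∑ j, N.A₁ k i j • x k j - α k i • q) (x (k + 1) i)) ∧
    (∀ k i, ∃ q ∈ concaveSubdiff (fun y' => g i (yb k i) y') (∑ j, N.A₂ k i j • y k j),
      IsProjection Y (∑ j, N.A₂ k i j • y k j + β k i • q) (y (k + 1) i))

/-- The network achieves a Nash equilibrium: whatever the initial states (and whatever subgradients
are selected), all states of each subnetwork converge to a common limit, and the two limits form
a saddle point of the sum objective. -/
def AchievesNash {n₁ n₂ m₁ m₂ : ℕ} (N : CommNetwork n₁ n₂)
    (X : Set (RVec m₁)) (Y : Set (RVec m₂))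
    (f : Fin n₁ → RVec m₁ → RVec m₂ → ℝ) (g : Fin n₂ → RVec m₁ → RVec m₂ → ℝ)
    (α : ℕ → Fin n₁ → ℝ) (β : ℕ → Fin n₂ → ℝ) : Prop :=
  ∀ x y, IsTrajectory N X Y f g α β x y →
    ∃ xs ys, IsSaddlePoint X Y (fun x' y' => ∑ i, f i x' y') xs ys ∧
      (∀ i, Tendsto (fun k => x k i) atTop (𝓝 xs)) ∧
      (∀ i, Tendsto (fun k => y k i) atTop (𝓝 ys))

/-- The conditions on the base stepsizes `γ_k`. -/
def BaseStepsize (γ : ℕ → ℝ) : Prop :=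
  (∀ k, 0 < γ k) ∧
  Tendsto (fun k => γ k * ∑ s ∈ Finset.range k, γ s) atTop (𝓝 0) ∧
  Antitone γ ∧
  Tendsto (fun k => ∑ s ∈ Finset.range k, γ s) atTop atTop ∧
  Summable fun k => γ k ^ 2

/-! ### Real sequences -/

/-! The proof is a Lyapunov argument with time-varying weights. For a saddle point `(xs, ys)` of
`U`, take `V k`, the sum of `∑ i, φ₁ k i * ‖x k i - xs‖ ^ 2` and `∑ i, φ₂ k i * ‖y k i - ys‖ ^ 2`.
Passing to the limit in products of the matrices gives `φ(k+1)ᵀ A(k) = φ(k)ᵀ`, so averaging does not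
increase `V`, although the graphs need not be balanced. The factor `1 / φ i (k+1)` in the stepsize
cancels the weight of agent `i`, so all objectives enter the descent with the same coefficient `2 γ
k`. Adding the two subnetworks, the terms `U(x̄, ȳ)` at the weighted means cancel, and `V` decreases
by `2 γ k` times the gap `U(x̄, ys) - U(xs, ȳ) ≥ 0`, up to errors.

The errors come from disagreement and from delayed information. Products over a long enough window
have uniformly positive entries, hence contract the spread; as `∑ γ² < ∞`, the spread is summable
against `γ` (`summable_mul_spread`), and so is the delay error. To turn an error in `y` into an
error in `f i`, a Lipschitz bound in `y` is needed, whereas only the `x`-subgradients of `f i` are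
bounded. But the sum of the `f i` equals that of the `g j` on `X × Y` and is therefore Lipschitz in
`y`. For concave summands a lower bound on each increment and an upper bound on their sum control
every single one; the resulting Lipschitz constant grows bilinearly
(`exists_abs_sub_le_of_convexConcave_family`). This growth is at most a multiple of `1 + V`, so it
only perturbs `V` by summable factors.

Consequently `V` converges and `∑ γ (gap + e) < ∞`, where `e` collects the spreads and delay errors.
Since `∑ γ = ∞`, gap and spreads tend to zero along a subsequence; by compactness and strict
convexity the means converge to `(xs, ys)` along a further one. There `V` tends to zero, hence `V`
tends to zero altogether, and the uniform lower bound on the weights gives convergence of every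
state (`tendsto_saddlePoint`). -/

/-- A nonnegative sequence that contracts over blocks of length `B`, up to a summable perturbation,
is summable. -/
theorem summable_of_block_contraction {u c : ℕ → ℝ} {ρ : ℝ} {B : ℕ} (hu : ∀ k, 0 ≤ u k)
    (hc : ∀ k, 0 ≤ c k) (hρ : ρ < 1) (hsum : Summable c)
    (h : ∀ k, u (k + B) ≤ ρ * u k + c k) : Summable u := by
  -- Summing the hypothesis over `k < n` bounds the partial sum by itself times `ρ` plus a constant;
  -- since `ρ < 1` it can be solved for.
  have key : ∀ n, ∑ k ∈ Finset.range n, u k ≤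
      (∑ k ∈ Finset.range B, u k + ∑' k, c k) / (1 - ρ) := by
    intro n
    rw [le_div_iff₀ (by linarith)]
    have h1 : ∑ k ∈ Finset.range n, u k ≤ ∑ k ∈ Finset.range (B + n), u k :=
      Finset.sum_le_sum_of_subset_of_nonneg (Finset.range_mono (by omega)) fun i _ _ => hu i
    have h2 : ∑ k ∈ Finset.range (B + n), u k =
        ∑ k ∈ Finset.range B, u k + ∑ k ∈ Finset.range n, u (k + B) := by
      rw [Finset.sum_range_add]
      simp only [add_comm]
    have h3 : ∑ k ∈ Finset.range n, u (k + B) ≤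
        ρ * ∑ k ∈ Finset.range n, u k + ∑ k ∈ Finset.range n, c k := by
      rw [Finset.mul_sum, ← Finset.sum_add_distrib]
      exact Finset.sum_le_sum fun k _ => h k
    have h4 := hsum.sum_le_tsum (Finset.range n) fun k _ => hc k
    nlinarith
  exact summable_of_sum_range_le hu key

/-- A nonnegative almost-supermartingale converges and the decrements are summable. -/
theorem tendsto_and_summable_of_almost_antitone {V a b c : ℕ → ℝ} (hV : ∀ k, 0 ≤ V k)
    (ha : ∀ k, 0 ≤ a k) (hb : ∀ k, 0 ≤ b k) (hc : ∀ k, 0 ≤ c k)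
    (hsa : Summable a) (hsc : Summable c)
    (h : ∀ k, V (k + 1) ≤ (1 + a k) * V k - b k + c k) :
    (∃ l, Tendsto V atTop (𝓝 l)) ∧ Summable b := by
  -- Discrete Gronwall bound, with `∏ (1 + a j)` replaced by `exp (∑ a j)`. Once `V ≤ M`, the
  -- multiplicative perturbation becomes the additive summable one `d`.
  have hbd : ∀ k, V k ≤ Real.exp (∑ j ∈ Finset.range k, a j) *
      (V 0 + ∑ j ∈ Finset.range k, c j) := by
    intro k
    induction k with
    | zero => simp
    | succ k ih =>
      rw [Finset.sum_range_succ, Finset.sum_range_succ, Real.exp_add]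
      set S := ∑ j ∈ Finset.range k, a j
      set R := ∑ j ∈ Finset.range k, c j
      have hS : 1 ≤ Real.exp S :=
        Real.one_le_exp (Finset.sum_nonneg fun j _ => ha j)
      have hA : 1 + a k ≤ Real.exp (a k) := by linarith [Real.add_one_le_exp (a k)]
      have hA1 : 1 ≤ Real.exp (a k) := Real.one_le_exp (ha k)
      have hW : 0 ≤ Real.exp S * (V 0 + R) := (hV k).trans ih
      calc V (k + 1) ≤ (1 + a k) * V k + c k := by linarith [h k, hb k]
        _ ≤ Real.exp (a k) * (Real.exp S * (V 0 + R)) + 1 * c k := by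
            rw [one_mul]
            gcongr
            · exact hV k
        _ ≤ Real.exp (a k) * (Real.exp S * (V 0 + R)) + (Real.exp S * Real.exp (a k)) * c k := by
            gcongr
            · exact hc k
            · nlinarith
        _ = _ := by ring
  set M := Real.exp (∑' j, a j) * (V 0 + ∑' j, c j) with hM
  have hVM : ∀ k, V k ≤ M := fun k => (hbd k).trans <| by
    have h1 := hsa.sum_le_tsum (Finset.range k) fun j _ => ha j
    have h2 := hsc.sum_le_tsum (Finset.range k) fun j _ => hc j
    have h3 : 0 ≤ V 0 + ∑ j ∈ Finset.range k, c j :=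
      add_nonneg (hV 0) (Finset.sum_nonneg fun j _ => hc j)
    rw [hM]
    gcongr
  have hM0 : 0 ≤ M := (hV 0).trans (hVM 0)
  set d : ℕ → ℝ := fun k => M * a k + c k with hd
  have hsd : Summable d := (hsa.mul_left M).add hsc
  have hd0 : ∀ k, 0 ≤ d k := fun k => add_nonneg (mul_nonneg hM0 (ha k)) (hc k)
  have hstep : ∀ k, V (k + 1) ≤ V k - b k + d k := fun k => by
    have := mul_le_mul_of_nonneg_left (hVM k) (ha k)
    simp only [hd]
    nlinarith [h k]
  constructor
  · set W : ℕ → ℝ := fun k => V k - ∑ j ∈ Finset.range k, d j with hWd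
    have hanti : Antitone W := antitone_nat_of_succ_le fun k => by
      simp only [hWd, Finset.sum_range_succ]
      linarith [hstep k, hb k]
    have hbelow : BddBelow (Set.range W) := by
      refine ⟨-∑' j, d j, ?_⟩
      rintro _ ⟨k, rfl⟩
      have := hsd.sum_le_tsum (Finset.range k) fun j _ => hd0 j
      simp only [hWd]
      linarith [hV k]
    refine ⟨_, ((tendsto_atTop_ciInf hanti hbelow).add hsd.hasSum.tendsto_sum_nat).congr ?_⟩
    intro k
    simp [hWd]
  · refine summable_of_sum_range_le (c := V 0 + ∑' j, d j) hb fun n => ?_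
    have h1 : ∑ k ∈ Finset.range n, b k ≤ V 0 - V n + ∑ k ∈ Finset.range n, d k := by
      induction n with
      | zero => simp
      | succ n ih =>
        rw [Finset.sum_range_succ, Finset.sum_range_succ]
        linarith [hstep n]
    linarith [hsd.sum_le_tsum (Finset.range n) fun j _ => hd0 j, hV n]

/-- If `∑ γ = ∞` and `∑ γ w < ∞` then `w` is frequently small. -/
theorem frequently_lt_of_summable_mul {γ w : ℕ → ℝ} (hγ : ∀ k, 0 < γ k)
    (hdiv : Tendsto (fun k => ∑ s ∈ Finset.range k, γ s) atTop atTop)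
    (hs : Summable fun k => γ k * w k) {ε : ℝ} (hε : 0 < ε) : ∃ᶠ k in atTop, w k < ε := by
  intro hev
  have h1 : ∀ᶠ k in atTop, ‖γ k‖ ≤ ε⁻¹ * (γ k * w k) := by
    filter_upwards [hev] with k hk
    rw [not_lt] at hk
    rw [Real.norm_of_nonneg (hγ k).le, inv_mul_eq_div, le_div_iff₀ hε]
    exact mul_le_mul_of_nonneg_left hk (hγ k).le
  have h2 : Summable γ := (hs.mul_left ε⁻¹).of_norm_bounded_eventually_nat h1
  exact not_tendsto_atTop_of_tendsto_nhds h2.hasSum.tendsto_sum_nat hdiv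

/-- If `γ` is antitone and `γ u` is summable, then so is `γ` times the delayed sequence `u`. -/
theorem summable_mul_delay {γ u : ℕ → ℝ} (hγ : ∀ k, 0 ≤ γ k) (hanti : Antitone γ)
    (hu : ∀ k, 0 ≤ u k) (hs : Summable fun k => γ k * u k) (t : ℕ) :
    Summable fun k => γ k * u (k - t) := by
  -- Dropping the first `t` terms removes the truncation in `k - t`.
  rw [← summable_nat_add_iff t]
  refine Summable.of_nonneg_of_le (fun k => mul_nonneg (hγ _) (hu _)) (fun k => ?_) hs
  rw [Nat.add_sub_cancel]
  exact mul_le_mul_of_nonneg_right (hanti (Nat.le_add_right k t)) (hu k)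

/-- A bound valid from some time on holds at all times after enlarging the constant. -/
theorem exists_forall_le_mul_of_eventually {ι : Type*} [Finite ι] {γ : ℕ → ℝ}
    {u : ℕ → ι → ℝ} {C : ℝ} (hγ : ∀ k, 0 < γ k)
    (h : ∀ᶠ k in atTop, ∀ i, u k i ≤ C * γ k) :
    ∃ C', 0 ≤ C' ∧ ∀ k i, u k i ≤ C' * γ k := by
  have : Fintype ι := Fintype.ofFinite ι
  obtain ⟨K, hK⟩ := eventually_atTop.1 h
  set S := ∑ k ∈ Finset.range K, ∑ i, |u k i| / γ k with hS
  have hS0 : 0 ≤ S := Finset.sum_nonneg fun k _ => Finset.sum_nonneg fun i _ =>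
    div_nonneg (abs_nonneg _) (hγ k).le
  refine ⟨|C| + S, by positivity, fun k i => ?_⟩
  rcases le_or_gt K k with hk | hk
  · refine (hK k hk i).trans (mul_le_mul_of_nonneg_right ?_ (hγ k).le)
    linarith [le_abs_self C]
  · have h1 : |u k i| / γ k ≤ S := by
      refine (Finset.single_le_sum (f := fun i => |u k i| / γ k)
        (fun i _ => div_nonneg (abs_nonneg _) (hγ k).le) (Finset.mem_univ i)).trans ?_
      exact Finset.single_le_sum (f := fun k => ∑ i, |u k i| / γ k)
        (fun k _ => Finset.sum_nonneg fun i _ => div_nonneg (abs_nonneg _) (hγ k).le)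
        (Finset.mem_range.2 hk)
    rw [div_le_iff₀ (hγ k)] at h1
    nlinarith [le_abs_self (u k i), abs_nonneg C, hγ k]

/-! ### Spread of a family of vectors and stochastic matrices -/

/-- The largest distance between two members of a family. -/
noncomputable def spread {ι E : Type*} [PseudoMetricSpace E] (x : ι → E) : ℝ :=
  Metric.diam (Set.range x)

section Spread

variable {ι E : Type*} [NormedAddCommGroup E]

theorem spread_nonneg (x : ι → E) : 0 ≤ spread x := Metric.diam_nonneg

theorem norm_sub_le_spread [Finite ι] (x : ι → E) (i j : ι) : ‖x i - x j‖ ≤ spread x := by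
  rw [← dist_eq_norm]
  exact Metric.dist_le_diam_of_mem (Set.finite_range x).isBounded ⟨i, rfl⟩ ⟨j, rfl⟩

theorem spread_le {x : ι → E} {d : ℝ} (hd : 0 ≤ d) (h : ∀ i j, ‖x i - x j‖ ≤ d) :
    spread x ≤ d := by
  refine Metric.diam_le_of_forall_dist_le hd ?_
  rintro _ ⟨i, rfl⟩ _ ⟨j, rfl⟩
  rw [dist_eq_norm]
  exact h i j

variable [Fintype ι] [NormedSpace ℝ E]

/-- Two nonnegative combinations of equal mass `w` differ by at most `w` times the spread. -/
theorem norm_sum_smul_sub_sum_smul_le {p q : ι → ℝ} {w : ℝ} (hp : ∀ i, 0 ≤ p i)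
    (hq : ∀ i, 0 ≤ q i) (hpw : ∑ i, p i = w) (hqw : ∑ i, q i = w) (x : ι → E) :
    ‖∑ i, p i • x i - ∑ i, q i • x i‖ ≤ w * spread x := by
  have hw : 0 ≤ w := hpw ▸ Finset.sum_nonneg fun i _ => hp i
  rcases hw.eq_or_lt with hw0 | hw0
  · subst hw0
    rw [Finset.sum_eq_zero_iff_of_nonneg fun i _ => hp i] at hpw
    rw [Finset.sum_eq_zero_iff_of_nonneg fun i _ => hq i] at hqw
    simp [fun i => hpw i (Finset.mem_univ i), fun i => hqw i (Finset.mem_univ i)]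
  · have h1 : w • (∑ i, p i • x i - ∑ i, q i • x i) =
        ∑ i, ∑ j, (p i * q j) • (x i - x j) := by
      simp only [smul_sub, Finset.sum_sub_distrib]
      congr 1
      · rw [Finset.smul_sum]
        refine Finset.sum_congr rfl fun i _ => ?_
        rw [← Finset.sum_smul, ← Finset.mul_sum, hqw, smul_smul, mul_comm]
      · rw [Finset.sum_comm, Finset.smul_sum]
        refine Finset.sum_congr rfl fun i _ => ?_
        rw [← Finset.sum_smul, ← Finset.sum_mul, hpw, smul_smul]
    have h2 : ‖w • (∑ i, p i • x i - ∑ i, q i • x i)‖ ≤ ∑ i, ∑ j, (p i * q j) * spread x := by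
      rw [h1]
      refine (norm_sum_le _ _).trans (Finset.sum_le_sum fun i _ => ?_)
      refine (norm_sum_le _ _).trans (Finset.sum_le_sum fun j _ => ?_)
      rw [norm_smul, Real.norm_of_nonneg (mul_nonneg (hp i) (hq j))]
      exact mul_le_mul_of_nonneg_left (norm_sub_le_spread x i j) (mul_nonneg (hp i) (hq j))
    have h3 : ∑ i, ∑ j, (p i * q j) * spread x = w * (w * spread x) := by
      simp only [← Finset.sum_mul, ← Finset.mul_sum, hpw, hqw, mul_assoc]
    rw [h3, norm_smul, Real.norm_of_nonneg hw] at h2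
    exact le_of_mul_le_mul_left h2 hw0

/-- Two convex combinations differ by at most the spread. -/
theorem norm_convexComb_sub_convexComb_le {p q : ι → ℝ} (hp : ∀ i, 0 ≤ p i)
    (hq : ∀ i, 0 ≤ q i) (hp1 : ∑ i, p i = 1) (hq1 : ∑ i, q i = 1) (x : ι → E) :
    ‖∑ i, p i • x i - ∑ i, q i • x i‖ ≤ spread x := by
  simpa using norm_sum_smul_sub_sum_smul_le hp hq hp1 hq1 x

/-- Nonnegative matrices with row sums one. -/
def IsRowStochastic (Q : Matrix ι ι ℝ) : Prop := (∀ i j, 0 ≤ Q i j) ∧ ∀ i, ∑ j, Q i j = 1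

theorem IsRowStochastic.one [DecidableEq ι] : IsRowStochastic (1 : Matrix ι ι ℝ) := by
  refine ⟨fun i j => ?_, fun i => ?_⟩
  · rw [Matrix.one_apply]; split_ifs <;> norm_num
  · simp [Matrix.one_apply]

theorem IsRowStochastic.mul {P Q : Matrix ι ι ℝ} (hP : IsRowStochastic P)
    (hQ : IsRowStochastic Q) : IsRowStochastic (P * Q) := by
  refine ⟨fun i j => ?_, fun i => ?_⟩
  · rw [Matrix.mul_apply]
    exact Finset.sum_nonneg fun k _ => mul_nonneg (hP.1 i k) (hQ.1 k j)
  · simp only [Matrix.mul_apply]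
    rw [Finset.sum_comm]
    simp only [← Finset.mul_sum, hQ.2, mul_one, hP.2]

/-- A row stochastic matrix with entries at least `c` contracts the spread by `1 - c`. -/
theorem IsRowStochastic.norm_sub_le_of_le {Q : Matrix ι ι ℝ} (hQ : IsRowStochastic Q) {c : ℝ}
    (hc : ∀ i j, c ≤ Q i j) (x : ι → E) (i j : ι) :
    ‖∑ k, Q i k • x k - ∑ k, Q j k • x k‖ ≤ (1 - c) * spread x := by
  classical
  -- Every row has mass at least `c` in the one column `i`. This common part cancels in the
  -- difference and leaves rows of mass `1 - c`.
  have hrow : ∀ a, ∑ k, (Q a k - if k = i then c else 0) = 1 - c := fun a => by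
    rw [Finset.sum_sub_distrib, hQ.2 a]; simp
  have hnn : ∀ a k, 0 ≤ Q a k - if k = i then c else 0 := fun a k => by
    split_ifs
    · linarith [hc a k]
    · linarith [hQ.1 a k]
  have h := norm_sum_smul_sub_sum_smul_le (hnn i) (hnn j) (hrow i) (hrow j) x
  simpa [sub_smul, Finset.sum_sub_distrib] using h

theorem IsRowStochastic.spread_le_of_le {Q : Matrix ι ι ℝ} (hQ : IsRowStochastic Q) {c : ℝ}
    (hc1 : c ≤ 1) (hc : ∀ i j, c ≤ Q i j) (x : ι → E) :
    spread (fun i => ∑ k, Q i k • x k) ≤ (1 - c) * spread x :=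
  spread_le (mul_nonneg (by linarith) (spread_nonneg x)) (hQ.norm_sub_le_of_le hc x)

end Spread

/-! ### Products of stochastic matrices -/

/-- The product `A(s+m-1) ⋯ A(s)` of `m` consecutive matrices. -/
noncomputable def blockProd {n : ℕ} (A : ℕ → Matrix (Fin n) (Fin n) ℝ) (s : ℕ) :
    ℕ → Matrix (Fin n) (Fin n) ℝ
  | 0 => 1
  | m + 1 => A (s + m) * blockProd A s m

section BlockProd

variable {n : ℕ} {A : ℕ → Matrix (Fin n) (Fin n) ℝ}

theorem transition_of_lt (A : ℕ → Matrix (Fin n) (Fin n) ℝ) {r s : ℕ} (h : r < s) :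
    transition A r s = 1 := by
  cases r with
  | zero => rw [transition, if_neg (by omega)]
  | succ r => rw [transition, if_neg (by omega)]

theorem transition_add (A : ℕ → Matrix (Fin n) (Fin n) ℝ) (s m : ℕ) :
    transition A (m + s) s = blockProd A s (m + 1) := by
  induction m with
  | zero =>
    cases s with
    | zero => simp [transition, blockProd]
    | succ s =>
      rw [zero_add, transition, if_pos le_rfl, transition_of_lt A (Nat.lt_succ_self s)]
      simp [blockProd]
  | succ m ih =>
    rw [show m + 1 + s = (m + s) + 1 by omega, transition, if_pos (by omega), ih]
    conv_rhs => rw [blockProd]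
    congr 2
    omega

/-- The definition appends the newest factor; splitting off the oldest one is what yields the
recursion between consecutive limit vectors. -/
theorem blockProd_succ (A : ℕ → Matrix (Fin n) (Fin n) ℝ) (s m : ℕ) :
    blockProd A s (m + 1) = blockProd A (s + 1) m * A s := by
  induction m with
  | zero => simp [blockProd]
  | succ m ih =>
    rw [blockProd, ih, blockProd, Matrix.mul_assoc]
    congr 2
    omega

theorem isRowStochastic_blockProd (hA : ∀ k, IsRowStochastic (A k)) (s m : ℕ) :
    IsRowStochastic (blockProd A s m) := by
  induction m with
  | zero => exact IsRowStochastic.one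
  | succ m ih => exact (hA _).mul ih

/-- In a strongly connected digraph, some arc leaves every nonempty proper set of nodes. -/
theorem StronglyConnected.exists_arc {V : Type*} {R : V → V → Prop} (hR : StronglyConnected R)
    {S : Set V} {u v : V} (hu : u ∈ S) (hv : v ∉ S) : ∃ a b, R a b ∧ a ∈ S ∧ b ∉ S := by
  by_contra! hcon
  have : ∀ w, Relation.ReflTransGen R u w → w ∈ S := fun w hw => by
    induction hw with
    | refl => exact hu
    | tail _ hbc ih => exact hcon _ _ hbc ih
  exact hv (this v (hR u v))

theorem pow_le_blockProd_succ (hA : ∀ k, IsRowStochastic (A k)) {η : ℝ} (hη : 0 ≤ η)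
    {s m : ℕ} {i j l : Fin n} (hl : η ^ m ≤ blockProd A s m l j) (hil : η ≤ A (s + m) i l) :
    η ^ (m + 1) ≤ blockProd A s (m + 1) i j := by
  rw [blockProd, Matrix.mul_apply, pow_succ']
  refine (mul_le_mul hil hl (by positivity) (hη.trans hil)).trans ?_
  exact Finset.single_le_sum (f := fun l => A (s + m) i l * blockProd A s m l j)
    (fun k _ => mul_nonneg ((hA _).1 i k) ((isRowStochastic_blockProd hA s m).1 k j))
    (Finset.mem_univ l)

theorem pow_le_blockProd_add (hA : ∀ k, IsRowStochastic (A k)) {η : ℝ} (hη : 0 ≤ η)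
    (hdiag : ∀ k i, η ≤ A k i i) {s m : ℕ} {i j : Fin n}
    (h : η ^ m ≤ blockProd A s m i j) (t : ℕ) :
    η ^ (m + t) ≤ blockProd A s (m + t) i j := by
  induction t with
  | zero => exact h
  | succ t ih => exact pow_le_blockProd_succ hA hη ih (hdiag _ i)

/-- Over a window of `n T` steps, all entries of the product are uniformly positive. -/
theorem pow_le_blockProd (hA : ∀ k, IsRowStochastic (A k)) {η : ℝ} (hη : 0 ≤ η)
    (hdiag : ∀ k i, η ≤ A k i i) {E : ℕ → Fin n → Fin n → Prop}
    (harc : ∀ k i j, E k j i → η ≤ A k i j) {T : ℕ}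
    (hconn : ∀ k, StronglyConnected (unionArc E k (k + T))) (s : ℕ) (i j : Fin n) :
    η ^ (n * T) ≤ blockProd A s (n * T) i j := by
  classical
  -- `R m` contains the agents certified to be reached from `j` within `m` steps. Self-loops keep it
  -- from shrinking, and each window of length `T` adds an agent until it is everything.
  set R : ℕ → Finset (Fin n) := fun m => {i | η ^ m ≤ blockProd A s m i j} with hRdef
  have hmem : ∀ m i, i ∈ R m ↔ η ^ m ≤ blockProd A s m i j := fun m i => by simp [hRdef]
  have hmono : ∀ m t, R m ⊆ R (m + t) := fun m t i hi => by
    rw [hmem] at hi ⊢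
    exact pow_le_blockProd_add hA hη hdiag hi t
  have hj : ∀ m, j ∈ R m := fun m => by
    have : j ∈ R 0 := by simp [hmem, blockProd]
    simpa using hmono 0 m this
  have hgrow : ∀ w, min n (w + 1) ≤ (R (w * T)).card := fun w => by
    induction w with
    | zero =>
      refine (min_le_right _ _).trans ?_
      exact Finset.card_pos.2 ⟨j, hj _⟩
    | succ w ih =>
      rw [show (w + 1) * T = w * T + T by ring]
      by_cases hfull : R (w * T) = Finset.univ
      · have : R (w * T + T) = Finset.univ :=
          Finset.univ_subset_iff.1 (hfull ▸ hmono (w * T) T)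
        rw [this, Finset.card_univ, Fintype.card_fin]
        exact min_le_left _ _
      · obtain ⟨v, hv⟩ : ∃ v, v ∉ R (w * T) := by
          by_contra! hall
          exact hfull (Finset.eq_univ_iff_forall.2 hall)
        obtain ⟨a, b, ⟨t, ht1, ht2, hE⟩, ha, hb⟩ :=
          (hconn (s + w * T)).exists_arc (S := R (w * T)) (hj (w * T)) hv
        obtain ⟨d, rfl⟩ : ∃ d, t = s + (w * T + d) := ⟨t - (s + w * T), by omega⟩
        have hb' : b ∈ R (w * T + T) := by
          have h1 : b ∈ R (w * T + d + 1) := by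
            rw [hmem]
            exact pow_le_blockProd_succ hA hη ((hmem _ _).1 (hmono _ d ha)) (harc _ _ _ hE)
          -- After `b` has been reached by the arc, self-loops carry it to the end of the window.
          have h2 := hmono (w * T + d + 1) (T - (d + 1)) h1
          rwa [show w * T + d + 1 + (T - (d + 1)) = w * T + T by omega] at h2
        have hlt : (R (w * T)).card < (R (w * T + T)).card :=
          Finset.card_lt_card ⟨hmono _ _, fun hsub => hb (hsub hb')⟩
        omega
  have huniv : R (n * T) = Finset.univ := by
    rw [← Finset.card_eq_iff_eq_univ, Fintype.card_fin]
    refine le_antisymm ?_ ?_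
    · simpa using Finset.card_le_univ (R (n * T))
    · have := hgrow n
      omega
  exact (hmem _ _).1 (huniv ▸ Finset.mem_univ i)

/-- If all block products of length `B` have entries at least `c > 0`, then the products converge to
rank one matrices with positive stochastic rows. -/
theorem exists_limit_blockProd (hA : ∀ k, IsRowStochastic (A k)) {c : ℝ} {B : ℕ} (hc0 : 0 < c)
    (hc1 : c ≤ 1) (hc : ∀ s i j, c ≤ blockProd A s B i j) :
    ∃ φ : ℕ → Fin n → ℝ, (∀ s j, c ≤ φ s j) ∧
      ∀ s i j, Tendsto (fun m => blockProd A s m i j) atTop (𝓝 (φ s j)) := by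
  have hadd : ∀ s m l, blockProd A s (m + l) = blockProd A (s + m) l * blockProd A s m := by
    intro s m l
    induction l with
    | zero => simp [blockProd]
    | succ l ih => rw [← add_assoc, blockProd, ih, blockProd, Matrix.mul_assoc, add_assoc]
  have hcol : ∀ s j, ∃ v, c ≤ v ∧ ∀ i, Tendsto (fun m => blockProd A s m i j) atTop (𝓝 v) := by
    intro s j
    -- Column `j` evolves by averaging, so its spread decays over blocks of length `B` and is
    -- summable. Consecutive entries differ by at most the spread, which gives a Cauchy sequence,
    -- with the same limit in every row.
    set z : ℕ → Fin n → ℝ := fun m i => blockProd A s m i j with hz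
    have hzadd : ∀ m l i, z (m + l) i = ∑ k, blockProd A (s + m) l i k • z m k := by
      intro m l i
      simp [hz, hadd, Matrix.mul_apply]
    have hsum : Summable fun m => spread (z m) := by
      refine summable_of_block_contraction (c := fun _ => 0) (ρ := 1 - c) (B := B)
        (fun m => spread_nonneg _) (fun _ => le_rfl) (by linarith) summable_zero fun m => ?_
      have h := (isRowStochastic_blockProd hA (s + m) B).spread_le_of_le hc1 (hc (s + m)) (z m)
      rw [add_zero]
      rwa [show z (m + B) = fun i => ∑ k, blockProd A (s + m) B i k • z m k from
        funext (hzadd m B)]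
    have hcau : CauchySeq fun m => z m j := by
      refine cauchySeq_of_summable_dist (Summable.of_nonneg_of_le (fun _ => dist_nonneg)
        (fun m => ?_) hsum)
      have h1 := norm_convexComb_sub_convexComb_le (IsRowStochastic.one.1 j)
        ((isRowStochastic_blockProd hA (s + m) 1).1 j) (IsRowStochastic.one.2 j)
        ((isRowStochastic_blockProd hA (s + m) 1).2 j) (z m)
      rw [← hzadd m 1 j] at h1
      rw [dist_eq_norm]
      simpa [Matrix.one_apply] using h1
    obtain ⟨v, hv⟩ := cauchySeq_tendsto_of_complete hcau
    refine ⟨v, ?_, fun i => ?_⟩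
    -- From length `B` on, the entries are averages of entries of a block of length `B`.
    · refine ge_of_tendsto hv (eventually_atTop.2 ⟨B, fun m hm => ?_⟩)
      obtain ⟨l, rfl⟩ := Nat.exists_eq_add_of_le hm
      rw [hzadd]
      have hst := isRowStochastic_blockProd hA (s + B) l
      calc c = ∑ k, blockProd A (s + B) l j k * c := by rw [← Finset.sum_mul, hst.2, one_mul]
        _ ≤ _ := Finset.sum_le_sum fun k _ =>
            mul_le_mul_of_nonneg_left (hc s k j) (hst.1 j k)
    · have h0 : Tendsto (fun m => z m i - z m j) atTop (𝓝 0) :=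
        squeeze_zero_norm (fun m => norm_sub_le_spread (z m) i j) hsum.tendsto_atTop_zero
      simpa using h0.add hv
  choose φ h1 h2 using hcol
  exact ⟨φ, h1, fun s i j => h2 s j i⟩

/-- Properties of the limit vectors of a sequence of stochastic matrices. -/
structure IsLimitFamily {n : ℕ} (A : ℕ → Matrix (Fin n) (Fin n) ℝ) (φ : ℕ → Fin n → ℝ) (c : ℝ) :
    Prop where
  pos : 0 < c
  le : ∀ s i, c ≤ φ s i
  sum_eq_one : ∀ s, ∑ i, φ s i = 1
  step : ∀ s j, ∑ i, φ (s + 1) i * A s i j = φ s j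

theorem IsLimitFamily.nonneg {φ : ℕ → Fin n → ℝ} {c : ℝ} (h : IsLimitFamily A φ c) (s : ℕ)
    (i : Fin n) : 0 ≤ φ s i := h.pos.le.trans (h.le s i)

/-- This invariance of the weighted mean under averaging plays the role that double stochasticity
has for balanced graphs. -/
theorem IsLimitFamily.sum_smul {φ : ℕ → Fin n → ℝ} {c : ℝ} (h : IsLimitFamily A φ c)
    {E : Type*} [AddCommGroup E] [Module ℝ E] (s : ℕ) (x : Fin n → E) :
    ∑ i, φ (s + 1) i • ∑ j, A s i j • x j = ∑ j, φ s j • x j := by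
  simp only [Finset.smul_sum, smul_smul]
  rw [Finset.sum_comm]
  simp only [← Finset.sum_smul, h.step]

/-- All rows of the limit agree, so each property is read off in row `0`; the recursion is the limit
of the factorization of a product into a later block times `A s`. -/
theorem exists_isLimitFamily (hn : 0 < n) (hA : ∀ k, IsRowStochastic (A k)) {c : ℝ} {B : ℕ}
    (hc0 : 0 < c) (hc1 : c ≤ 1) (hc : ∀ s i j, c ≤ blockProd A s B i j) :
    ∃ φ : ℕ → Fin n → ℝ, IsLimitFamily A φ c ∧ ∀ s, IsLimitVector A s (φ s) := by
  obtain ⟨φ, hφc, hφ⟩ := exists_limit_blockProd hA hc0 hc1 hc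
  have hsum : ∀ s, ∑ i, φ s i = 1 := fun s => by
    refine tendsto_nhds_unique (tendsto_finsetSum Finset.univ fun j _ => hφ s ⟨0, hn⟩ j) ?_
    simp only [(isRowStochastic_blockProd hA s _).2]
    exact tendsto_const_nhds
  refine ⟨φ, ⟨hc0, hφc, hsum, fun s j => ?_⟩, fun s => ⟨fun i => hc0.trans_le (hφc s i), hsum s, ?_⟩⟩
  · have h1 : Tendsto (fun m => blockProd A s (m + 1) ⟨0, hn⟩ j) atTop (𝓝 (φ s j)) :=
      (hφ s ⟨0, hn⟩ j).comp (tendsto_add_atTop_nat 1)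
    refine tendsto_nhds_unique ?_ h1
    simp only [blockProd_succ, Matrix.mul_apply]
    exact tendsto_finsetSum _ fun i _ => (hφ (s + 1) ⟨0, hn⟩ i).mul_const _
  · rw [← tendsto_add_atTop_iff_nat s]
    simp only [transition_add]
    refine tendsto_pi_nhds.2 fun i => tendsto_pi_nhds.2 fun j => ?_
    have := (hφ s i j).comp (tendsto_add_atTop_nat 1)
    simpa [Matrix.vecMulVec_apply, Function.comp_def] using this

end BlockProd

/-! ### Perturbed consensus -/

section Consensus

variable {n : ℕ} {A : ℕ → Matrix (Fin n) (Fin n) ℝ} {E : Type*} [NormedAddCommGroup E]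
  [NormedSpace ℝ E] {x : ℕ → Fin n → E} {γ : ℕ → ℝ} {C : ℝ}

/-- Averaging with stochastic rows does not amplify earlier errors, so the `m` perturbations add up,
each at most `C * γ k` by monotonicity. -/
theorem norm_sub_blockProd_le (hA : ∀ k, IsRowStochastic (A k)) (hC : 0 ≤ C) (hanti : Antitone γ)
    (hx : ∀ k i, ‖x (k + 1) i - ∑ j, A k i j • x k j‖ ≤ C * γ k) (k m : ℕ) (i : Fin n) :
    ‖x (k + m) i - ∑ j, blockProd A k m i j • x k j‖ ≤ m * (C * γ k) := by
  induction m generalizing i with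
  | zero => simp [blockProd, Matrix.one_apply]
  | succ m ih =>
    have h1 : x (k + (m + 1)) i - ∑ j, blockProd A k (m + 1) i j • x k j =
        (x (k + m + 1) i - ∑ l, A (k + m) i l • x (k + m) l) +
          ∑ l, A (k + m) i l • (x (k + m) l - ∑ j, blockProd A k m l j • x k j) := by
      have : ∑ j, blockProd A k (m + 1) i j • x k j =
          ∑ l, A (k + m) i l • ∑ j, blockProd A k m l j • x k j := by
        simp only [blockProd, Matrix.mul_apply, Finset.sum_smul, Finset.smul_sum, smul_smul]
        rw [Finset.sum_comm]
      rw [this]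
      simp only [smul_sub, Finset.sum_sub_distrib]
      rw [← add_assoc]
      abel
    have h2 : ‖∑ l, A (k + m) i l • (x (k + m) l - ∑ j, blockProd A k m l j • x k j)‖ ≤
        m * (C * γ k) := by
      calc _ ≤ ∑ l, A (k + m) i l * (m * (C * γ k)) := by
            refine (norm_sum_le _ _).trans (Finset.sum_le_sum fun l _ => ?_)
            rw [norm_smul, Real.norm_of_nonneg ((hA _).1 i l)]
            exact mul_le_mul_of_nonneg_left (ih l) ((hA _).1 i l)
        _ = _ := by rw [← Finset.sum_mul, (hA _).2, one_mul]
    rw [h1]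
    refine (norm_add_le _ _).trans ?_
    have h3 := (hx (k + m) i).trans
      (mul_le_mul_of_nonneg_left (hanti (Nat.le_add_right k m)) hC)
    push_cast
    linarith

/-- Under perturbations of order `γ k`, the spread is summable against `γ`. -/
theorem summable_mul_spread (hA : ∀ k, IsRowStochastic (A k)) {c : ℝ} {B : ℕ} (hc0 : 0 < c)
    (hc1 : c ≤ 1) (hc : ∀ s i j, c ≤ blockProd A s B i j) (hγ : ∀ k, 0 ≤ γ k)
    (hanti : Antitone γ) (hsq : Summable fun k => γ k ^ 2) (hC : 0 ≤ C)
    (hx : ∀ k i, ‖x (k + 1) i - ∑ j, A k i j • x k j‖ ≤ C * γ k) :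
    Summable fun k => γ k * spread (x k) := by
  refine summable_of_block_contraction (c := fun k => 2 * B * C * γ k ^ 2) (ρ := 1 - c) (B := B)
    (fun k => mul_nonneg (hγ k) (spread_nonneg _)) (fun k => by positivity) (by linarith)
    (hsq.mul_left _) fun k => ?_
  -- Each state deviates by at most `B * C * γ k` from an exact average, and the averages have
  -- contracted by `1 - c`.
  have h1 : spread (x (k + B)) ≤ (1 - c) * spread (x k) + 2 * B * C * γ k := by
    refine spread_le ?_ fun i j => ?_
    · have := mul_nonneg (sub_nonneg.2 hc1) (spread_nonneg (x k))
      have := hγ k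
      positivity
    · have hi := norm_sub_blockProd_le hA hC hanti hx k B i
      have hj := norm_sub_blockProd_le hA hC hanti hx k B j
      have hij := (isRowStochastic_blockProd hA k B).norm_sub_le_of_le (hc k) (x k) i j
      set a := ∑ l, blockProd A k B i l • x k l
      set b := ∑ l, blockProd A k B j l • x k l
      calc ‖x (k + B) i - x (k + B) j‖
          = ‖(x (k + B) i - a) + (a - b) - (x (k + B) j - b)‖ := by congr 1; abel
        _ ≤ ‖x (k + B) i - a‖ + ‖a - b‖ + ‖x (k + B) j - b‖ :=
            (norm_sub_le _ _).trans (add_le_add_left (norm_add_le _ _) _)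
        _ ≤ _ := by linarith
  have h2 : γ (k + B) ≤ γ k := hanti (Nat.le_add_right k B)
  calc γ (k + B) * spread (x (k + B)) ≤ γ k * ((1 - c) * spread (x k) + 2 * B * C * γ k) :=
        mul_le_mul h2 h1 (spread_nonneg _) (hγ k)
    _ = _ := by ring

end Consensus

/-! ### Subgradients and projections -/

section Convex

variable {m : ℕ}

/-- A hyperplane separating the open strict epigraph from `(z, φ z)` cannot be vertical, and its
slope is a subgradient. -/
theorem convexSubdiff_nonempty {φ : RVec m → ℝ} (hφ : ConvexOn ℝ Set.univ φ) (z : RVec m) :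
    (convexSubdiff φ z).Nonempty := by
  have hcont : Continuous φ := by
    rw [← continuousOn_univ]
    exact hφ.continuousOn isOpen_univ
  have hconv : Convex ℝ {p : RVec m × ℝ | φ p.1 < p.2} := by
    simpa using hφ.convex_strict_epigraph
  have hopen : IsOpen {p : RVec m × ℝ | φ p.1 < p.2} :=
    isOpen_lt (hcont.comp continuous_fst) continuous_snd
  obtain ⟨F, hF⟩ := geometric_hahn_banach_open_point (x := (z, φ z)) hconv hopen
    (by simp)
  set t := F (0, 1) with ht
  have hsplit : ∀ w s, F (w, s) = F (w, 0) + s * t := fun w s => by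
    have : ((w, s) : RVec m × ℝ) = (w, 0) + s • (0, 1) := by simp
    rw [this, map_add, map_smul, smul_eq_mul]
  have ht0 : t < 0 := by
    have := hF (z, φ z + 1) (by simp)
    rw [hsplit z (φ z + 1), hsplit z (φ z)] at this
    linarith
  have hle : ∀ w, F (w, 0) + φ w * t ≤ F (z, 0) + φ z * t := fun w => by
    refine le_of_forall_pos_lt_add fun ε hε => ?_
    -- The epigraph is strict, so the graph is approached from above; this height changes `F` by
    -- exactly `ε`.
    have := hF (w, φ w + ε / (-t)) (by simp [hε, ht0])
    rw [hsplit w, hsplit z, add_mul, div_mul_eq_mul_div, mul_div_assoc,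
      div_neg, div_self ht0.ne] at this
    linarith
  set G : RVec m →L[ℝ] ℝ := (-t)⁻¹ • F.comp (ContinuousLinearMap.inl ℝ (RVec m) ℝ) with hG
  refine ⟨(InnerProductSpace.toDual ℝ (RVec m)).symm G, fun w => ?_⟩
  rw [real_inner_comm, InnerProductSpace.toDual_symm_apply]
  have h1 : G (w - z) = (-t)⁻¹ * (F (w, 0) - F (z, 0)) := by
    simp [hG, ← map_sub]
  rw [h1, inv_mul_eq_div, ge_iff_le, ← le_sub_iff_add_le', div_le_iff₀ (by linarith)]
  linarith [hle w]

theorem mem_concaveSubdiff_iff_neg {φ : RVec m → ℝ} {z q : RVec m} :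
    q ∈ concaveSubdiff φ z ↔ -q ∈ convexSubdiff (fun w => -φ w) z := by
  simp only [concaveSubdiff, convexSubdiff, Set.mem_ofPred_eq, inner_neg_right]
  refine forall_congr' fun w => ?_
  constructor <;> intro h <;> linarith

theorem concaveSubdiff_nonempty {φ : RVec m → ℝ} (hφ : ConcaveOn ℝ Set.univ φ) (z : RVec m) :
    (concaveSubdiff φ z).Nonempty := by
  obtain ⟨q, hq⟩ := convexSubdiff_nonempty hφ.neg z
  exact ⟨-q, mem_concaveSubdiff_iff_neg.2 (by rw [neg_neg]; exact hq)⟩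

/-- A convex function with subgradients bounded by `L` on `K` is `L`-Lipschitz on `K`. -/
theorem sub_le_of_convexSubdiff_bounded {φ : RVec m → ℝ} (hφ : ConvexOn ℝ Set.univ φ)
    {K : Set (RVec m)} {L : ℝ} (hL : ∀ x ∈ K, ∀ q ∈ convexSubdiff φ x, ‖q‖ ≤ L)
    {x : RVec m} (hx : x ∈ K) (x' : RVec m) : φ x - φ x' ≤ L * ‖x - x'‖ := by
  obtain ⟨q, hq⟩ := convexSubdiff_nonempty hφ x
  have h1 : φ x' ≥ φ x + inner ℝ (x' - x) q := hq x'
  have h2 : inner ℝ (x - x') q ≤ ‖x - x'‖ * ‖q‖ := real_inner_le_norm _ _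
  have h3 : ‖x - x'‖ * ‖q‖ ≤ ‖x - x'‖ * L :=
    mul_le_mul_of_nonneg_left (hL x hx q hq) (norm_nonneg _)
  rw [← neg_sub x x', inner_neg_left] at h1
  linarith

/-- The projection onto a convex set does not increase the distance to its points. -/
theorem IsProjection.norm_sub_le {K : Set (RVec m)} (hK : Convex ℝ K) {z p w : RVec m}
    (hp : IsProjection K z p) (hw : w ∈ K) : ‖p - w‖ ≤ ‖z - w‖ := by
  have h1 : ‖z - p‖ = ⨅ v : K, ‖z - v‖ := by
    rw [hp.2, Metric.infDist_eq_iInf]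
    simp only [dist_eq_norm]
  have h2 := (norm_eq_iInf_iff_real_inner_le_zero hK hp.1).1 h1 w hw
  have h3 : ‖z - w‖ ^ 2 = ‖z - p‖ ^ 2 - 2 * inner ℝ (z - p) (w - p) + ‖p - w‖ ^ 2 := by
    rw [norm_sub_rev p w, ← norm_sub_sq_real, sub_sub_sub_cancel_right]
  refine le_of_sq_le_sq ?_ (norm_nonneg _)
  nlinarith [sq_nonneg ‖z - p‖]

end Convex

/-! ### Variation of convex-concave functions in the second argument -/

/-- A relative interior point of a convex set, in a form suited to differences of points. -/
theorem exists_relInterior_point {m : ℕ} {Y : Set (RVec m)} (hY : Convex ℝ Y) (hne : Y.Nonempty) :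
    ∃ y₀ ∈ Y, ∃ r > 0, ∀ u ∈ Y, ∀ v ∈ Y, ∀ t : ℝ, ‖t • (u - v)‖ ≤ r → y₀ + t • (u - v) ∈ Y := by
  obtain ⟨y₀, hy₀⟩ := hne.intrinsicInterior hY
  obtain ⟨⟨y, hyspan⟩, hy, rfl⟩ := mem_intrinsicInterior.1 hy₀
  obtain ⟨r, hr, hball⟩ := Metric.mem_nhds_iff.1 (mem_interior_iff_mem_nhds.1 hy)
  -- Half the radius, since the ball is open and the bound on `t • (u - v)` is not strict.
  refine ⟨y, intrinsicInterior_subset hy₀, r / 2, by positivity, fun u hu v hv t ht => ?_⟩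
  have hdir : t • (u - v) ∈ (affineSpan ℝ Y).direction :=
    Submodule.smul_mem _ t (AffineSubspace.vsub_mem_direction
      (subset_affineSpan ℝ Y hu) (subset_affineSpan ℝ Y hv))
  have hmem : y + t • (u - v) ∈ affineSpan ℝ Y := by
    rw [add_comm]
    exact AffineSubspace.vadd_mem_of_mem_direction hdir hyspan
  have : (⟨y + t • (u - v), hmem⟩ : affineSpan ℝ Y) ∈ Metric.ball ⟨y, hyspan⟩ r := by
    rw [Metric.mem_ball, Subtype.dist_eq, dist_eq_norm, add_sub_cancel_left]
    linarith
  exact hball this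

theorem norm_le_of_forall_basis {m : ℕ} {s : RVec m} {d : ℝ}
    (h : ∀ l, |inner ℝ (EuclideanSpace.basisFun (Fin m) ℝ l) s| ≤ d) : ‖s‖ ≤ m * d := by
  have h1 := (EuclideanSpace.basisFun (Fin m) ℝ).sum_repr' s
  calc ‖s‖ = ‖∑ l, inner ℝ (EuclideanSpace.basisFun (Fin m) ℝ l) s •
          EuclideanSpace.basisFun (Fin m) ℝ l‖ := by rw [h1]
    _ ≤ ∑ _l : Fin m, d := by
        refine (norm_sum_le _ _).trans (Finset.sum_le_sum fun l _ => ?_)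
        rw [norm_smul, OrthonormalBasis.norm_eq_one, mul_one]
        exact h l
    _ = m * d := by simp

/-- A convex-concave function that is Lipschitz in the first argument at one value of the second
argument grows at most bilinearly. -/
theorem ConvexConcave.exists_le_bilinear {m₁ m₂ : ℕ} {f : RVec m₁ → RVec m₂ → ℝ}
    (hf : ConvexConcave f) {X : Set (RVec m₁)} (x₀ : RVec m₁) (y₀ : RVec m₂) {L : ℝ} (hL0 : 0 ≤ L)
    (hL : ∀ x ∈ X, f x y₀ - f x₀ y₀ ≤ L * ‖x - x₀‖) :
    ∃ C, 0 ≤ C ∧ ∀ x ∈ X, ∀ y, f x y ≤ C * (1 + ‖x - x₀‖) * (1 + ‖y - y₀‖) := by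
  set e := EuclideanSpace.basisFun (Fin m₂) ℝ with he
  -- For fixed `z`, a subgradient at `x₀` bounds `f · z` below by a function of linear growth. This
  -- will be used only at the finitely many points `y₀ ± e l`.
  have hlow : ∀ z, ∃ v, ∀ x, f x₀ z + inner ℝ (x - x₀) v ≤ f x z := fun z =>
    convexSubdiff_nonempty (hf.1 z) x₀
  choose v hv using hlow
  set D : RVec m₂ → ℝ := fun z => |f x₀ z| + ‖v z‖ with hD
  have hlow' : ∀ z x, -(D z * (1 + ‖x - x₀‖)) ≤ f x z := fun z x => by
    have h1 := neg_le_of_abs_le (abs_real_inner_le_norm (x - x₀) (v z))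
    have h2 := neg_abs_le (f x₀ z)
    have h3 := mul_nonneg (abs_nonneg (f x₀ z)) (norm_nonneg (x - x₀))
    have h4 := norm_nonneg (v z)
    simp only [hD]
    nlinarith [hv z x]
  set P := |f x₀ y₀| + L with hP
  have hup : ∀ x ∈ X, f x y₀ ≤ P * (1 + ‖x - x₀‖) := fun x hx => by
    have h2 := le_abs_self (f x₀ y₀)
    have h3 := mul_nonneg (abs_nonneg (f x₀ y₀)) (norm_nonneg (x - x₀))
    simp only [hP]
    nlinarith [hL x hx]
  set Q := P + ∑ l, (D (y₀ + e l) + D (y₀ - e l)) with hQ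
  have hD0 : ∀ z, 0 ≤ D z := fun z => by positivity
  have hP0 : 0 ≤ P := by positivity
  have hQl : ∀ l, P + (D (y₀ + e l) + D (y₀ - e l)) ≤ Q := fun l => by
    have := Finset.single_le_sum (f := fun l => D (y₀ + e l) + D (y₀ - e l))
      (fun l _ => add_nonneg (hD0 _) (hD0 _)) (Finset.mem_univ l)
    linarith
  have hQ0 : 0 ≤ Q := add_nonneg hP0 (Finset.sum_nonneg fun l _ => add_nonneg (hD0 _) (hD0 _))
  refine ⟨P + m₂ * Q, by positivity, fun x hx y => ?_⟩
  obtain ⟨s, hs⟩ := concaveSubdiff_nonempty (hf.2 x) y₀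
  have hs' : ∀ w, f x w ≤ f x y₀ + inner ℝ (w - y₀) s := hs
  have hN : 0 ≤ 1 + ‖x - x₀‖ := by positivity
  -- The concave function `f x` is bounded above at `y₀` and below at `y₀ ± e l`, which limits each
  -- coordinate of its supergradient `s`. The supergradient inequality then gives the bound at every
  -- `y`.
  have hsn : ‖s‖ ≤ m₂ * (Q * (1 + ‖x - x₀‖)) := by
    refine norm_le_of_forall_basis fun l => abs_le.2 ⟨?_, ?_⟩
    · have h1 := hs' (y₀ + e l)
      rw [add_sub_cancel_left] at h1
      nlinarith [hlow' (y₀ + e l) x, hup x hx, hQl l, hD0 (y₀ - e l),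
        mul_le_mul_of_nonneg_right (hQl l) hN, mul_nonneg (hD0 (y₀ - e l)) hN]
    · have h1 := hs' (y₀ - e l)
      rw [sub_sub_cancel_left, inner_neg_left] at h1
      nlinarith [hlow' (y₀ - e l) x, hup x hx, hQl l, hD0 (y₀ + e l),
        mul_le_mul_of_nonneg_right (hQl l) hN, mul_nonneg (hD0 (y₀ + e l)) hN]
  have h1 : inner ℝ (y - y₀) s ≤ ‖y - y₀‖ * (m₂ * (Q * (1 + ‖x - x₀‖))) :=
    (real_inner_le_norm _ _).trans (mul_le_mul_of_nonneg_left hsn (norm_nonneg _))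
  have h2 := mul_nonneg (mul_nonneg hP0 hN) (norm_nonneg (y - y₀))
  have h3 : 0 ≤ m₂ * (Q * (1 + ‖x - x₀‖)) := by positivity
  nlinarith [hs' y, hup x hx]

/-- For concave functions with a Lipschitz sum, moving from `w` a fraction `θ` of the way to `z`
changes each function by `O(θ)`. -/
theorem abs_sub_le_of_concave_family {n m : ℕ} {Y : Set (RVec m)} {h : Fin n → RVec m → ℝ}
    (hconc : ∀ i, ConcaveOn ℝ Y (h i)) {y₀ : RVec m} {M L : ℝ}
    (hM : ∀ i, ∀ y ∈ Y, |h i y| ≤ M * (1 + ‖y - y₀‖))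
    (hL0 : 0 ≤ L) (hL : ∀ y ∈ Y, ∀ y' ∈ Y, ∑ i, h i y - ∑ i, h i y' ≤ L * ‖y - y'‖)
    {w z p : RVec m} (hw : w ∈ Y) (hz : z ∈ Y) {θ : ℝ} (hθ0 : 0 ≤ θ) (hθ1 : θ ≤ 1)
    (hp : p = (1 - θ) • w + θ • z) (i : Fin n) :
    |h i p - h i w| ≤ θ * (L + n * M) * (2 + ‖z - y₀‖ + ‖w - y₀‖) := by
  set H := M * (2 + ‖z - y₀‖ + ‖w - y₀‖) with hH
  have hpY : p ∈ Y := hp ▸ (hconc i).1 hw hz (by linarith) hθ0 (by ring)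
  -- Concavity along the segment from `w` to `z` gives the lower bound, for every member of the
  -- family.
  have hlow : ∀ j, -(θ * H) ≤ h j p - h j w := fun j => by
    have h1 := (hconc j).2 hw hz (show 0 ≤ 1 - θ by linarith) hθ0 (by ring)
    rw [← hp, smul_eq_mul, smul_eq_mul] at h1
    have h2 : -H ≤ h j z - h j w := by
      have := neg_le_of_abs_le (hM j z hz)
      have := le_of_abs_le (hM j w hw)
      rw [hH]
      linarith
    nlinarith [mul_le_mul_of_nonneg_left h2 hθ0]
  have hH0 : 0 ≤ θ * H := by
    have h1 := (abs_nonneg _).trans (hM i z hz)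
    have h2 := (abs_nonneg _).trans (hM i w hw)
    refine mul_nonneg hθ0 ?_
    rw [hH]
    linarith
  have hpw : ‖p - w‖ ≤ θ * (2 + ‖z - y₀‖ + ‖w - y₀‖) := by
    have h1 : p - w = θ • ((z - y₀) - (w - y₀)) := by rw [hp]; module
    rw [h1, norm_smul, Real.norm_of_nonneg hθ0]
    refine mul_le_mul_of_nonneg_left ?_ hθ0
    linarith [norm_sub_le (z - y₀) (w - y₀)]
  have hsum := (hL p hpY w hw).trans (mul_le_mul_of_nonneg_left hpw hL0)
  -- Shifted by `θ * H`, all increments are nonnegative, so each is at most their sum, which the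
  -- Lipschitz bound controls.
  have hup : h i p - h i w + θ * H ≤ ∑ j, (h j p - h j w + θ * H) :=
    Finset.single_le_sum (f := fun j => h j p - h j w + θ * H)
      (fun j _ => by linarith [hlow j]) (Finset.mem_univ i)
  rw [Finset.sum_add_distrib, Finset.sum_sub_distrib] at hup
  simp only [Finset.sum_const, Finset.card_univ, Fintype.card_fin, nsmul_eq_mul] at hup
  have hn : (1 : ℝ) ≤ n := by exact_mod_cast Fin.pos i
  have hS : 0 ≤ L * (θ * (2 + ‖z - y₀‖ + ‖w - y₀‖)) := by positivity
  have hnH : θ * H ≤ n * (θ * H) := le_mul_of_one_le_left hH0 hn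
  have hgoal : θ * (L + n * M) * (2 + ‖z - y₀‖ + ‖w - y₀‖) =
      L * (θ * (2 + ‖z - y₀‖ + ‖w - y₀‖)) + n * (θ * H) := by rw [hH]; ring
  rw [hgoal, abs_le]
  constructor
  · linarith [hlow i]
  · linarith

/-- Concave functions of linear growth with a Lipschitz sum: each is Lipschitz with a constant of
linear growth. -/
theorem abs_sub_le_mul_norm_of_concave_family {n m : ℕ} {Y : Set (RVec m)} {h : Fin n → RVec m → ℝ}
    (hconc : ∀ i, ConcaveOn ℝ Y (h i)) {y₀ : RVec m} {M L r : ℝ} (hM0 : 0 ≤ M) (hr : 0 < r)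
    (hy₀ : y₀ ∈ Y)
    (hrel : ∀ u ∈ Y, ∀ v ∈ Y, ∀ t : ℝ, ‖t • (u - v)‖ ≤ r → y₀ + t • (u - v) ∈ Y)
    (hM : ∀ i, ∀ y ∈ Y, |h i y| ≤ M * (1 + ‖y - y₀‖))
    (hL0 : 0 ≤ L) (hL : ∀ y ∈ Y, ∀ y' ∈ Y, ∑ i, h i y - ∑ i, h i y' ≤ L * ‖y - y'‖)
    {u v : RVec m} (hu : u ∈ Y) (hv : v ∈ Y) (i : Fin n) :
    |h i u - h i v| ≤ (L + n * M) * (4 / r + 2) * (1 + ‖v - y₀‖) * ‖u - v‖ := by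
  rcases eq_or_ne u v with rfl | huv
  · simp
  set δ := ‖u - v‖ with hδ
  have hδ0 : 0 < δ := norm_pos_iff.2 (sub_ne_zero.2 huv)
  -- With `z = y₀ + (r / δ) • (v - u)`, this `θ` makes the segments from `v` to `y₀` and from `u` to
  -- `z` meet at the same parameter. Both moves cover the fraction `θ ≤ δ / r`, so comparing `u` and
  -- `v` through the meeting point costs `O(δ)`.
  set θ := δ / (δ + r) with hθ
  have hθ0 : 0 ≤ θ := by positivity
  have hθ1 : θ ≤ 1 := by rw [hθ, div_le_one (by positivity)]; linarith
  have hnorm : ‖(r / δ) • (v - u)‖ = r := by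
    rw [norm_smul, norm_sub_rev, ← hδ, Real.norm_of_nonneg (by positivity),
      div_mul_cancel₀ _ hδ0.ne']
  have hz := hrel v hv u hu (r / δ) hnorm.le
  set z := y₀ + (r / δ) • (v - u) with hzdef
  have hzn : ‖z - y₀‖ = r := by rw [hzdef, add_sub_cancel_left, hnorm]
  have hpeq : (1 - θ) • v + θ • y₀ = (1 - θ) • u + θ • z := by
    have h1 : 1 - θ = θ * (r / δ) := by rw [hθ]; field_simp; ring
    have h2 : θ • z = θ • y₀ + (1 - θ) • (v - u) := by rw [hzdef, h1, smul_add, smul_smul]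
    rw [h2]
    module
  have h1 := abs_sub_le_of_concave_family hconc hM hL0 hL hu hz hθ0 hθ1 hpeq i
  have h2 := abs_sub_le_of_concave_family hconc hM hL0 hL hv hy₀ hθ0 hθ1 rfl i
  rw [hzn] at h1
  rw [sub_self, norm_zero] at h2
  set p := (1 - θ) • v + θ • y₀
  have h3 : |h i u - h i v| ≤ |h i p - h i u| + |h i p - h i v| := by
    rw [abs_sub_comm (h i p) (h i u)]
    exact abs_sub_le _ _ _
  have h4 : ‖u - y₀‖ ≤ δ + ‖v - y₀‖ := by
    have := norm_add_le (u - v) (v - y₀)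
    rwa [sub_add_sub_cancel] at this
  set a := ‖v - y₀‖
  have ha : 0 ≤ a := norm_nonneg _
  set K := L + n * M with hK
  have hK0 : 0 ≤ K := by positivity
  have hθr : θ ≤ δ / r := div_le_div_of_nonneg_left hδ0.le hr (by linarith)
  have hθδ : θ * δ ≤ δ := mul_le_of_le_one_left hδ0.le hθ1
  have h5 : θ * (4 + r + 2 * a + δ) ≤ (4 / r + 2) * (1 + a) * δ := by
    have h6 : θ * (4 + r + 2 * a) ≤ δ / r * (4 + r + 2 * a) :=
      mul_le_mul_of_nonneg_right hθr (by positivity)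
    have h7 : δ / r * (4 + r + 2 * a) + δ + (2 / r + 2) * a * δ = (4 / r + 2) * (1 + a) * δ := by
      field_simp
      ring
    have h8 : 0 ≤ (2 / r + 2) * a * δ := by positivity
    linarith
  calc |h i u - h i v| ≤ θ * K * (2 + r + ‖u - y₀‖) + θ * K * (2 + 0 + a) :=
        h3.trans (add_le_add h1 h2)
    _ = K * (θ * (4 + r + a + ‖u - y₀‖)) := by ring
    _ ≤ K * (θ * (4 + r + 2 * a + δ)) := by
        refine mul_le_mul_of_nonneg_left (mul_le_mul_of_nonneg_left ?_ hθ0) hK0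
        linarith
    _ ≤ K * ((4 / r + 2) * (1 + a) * δ) := mul_le_mul_of_nonneg_left h5 hK0
    _ = _ := by ring

/-- Suppose each `f i` is convex-concave and Lipschitz in the first argument, and `∑ i, f i` is
Lipschitz in the second one. Then each `f i` is Lipschitz in the second argument with a constant of
bilinear growth. -/
theorem exists_abs_sub_le_of_convexConcave_family {n m₁ m₂ : ℕ} {X : Set (RVec m₁)}
    {Y : Set (RVec m₂)} (hY : Convex ℝ Y) {f : Fin n → RVec m₁ → RVec m₂ → ℝ}
    (hf : ∀ i, ConvexConcave (f i)) {L L' : ℝ} (hL0 : 0 ≤ L) (hL0' : 0 ≤ L')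
    (hL : ∀ i, ∀ y ∈ Y, ∀ x ∈ X, ∀ x' ∈ X, f i x y - f i x' y ≤ L * ‖x - x'‖)
    (hL' : ∀ x ∈ X, ∀ y ∈ Y, ∀ y' ∈ Y, ∑ i, f i x y - ∑ i, f i x y' ≤ L' * ‖y - y'‖)
    {x₀ : RVec m₁} {y₁ : RVec m₂} (hx₀ : x₀ ∈ X) (hy₁ : y₁ ∈ Y) :
    ∃ C, 0 ≤ C ∧ ∀ i, ∀ x ∈ X, ∀ u ∈ Y, ∀ v ∈ Y,
      |f i x u - f i x v| ≤ C * ((1 + ‖x - x₀‖) * (1 + ‖v - y₁‖)) * ‖u - v‖ := by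
  obtain ⟨y₀, hy₀, r, hr, hrel⟩ := exists_relInterior_point hY ⟨y₁, hy₁⟩
  have hbil := fun i => (hf i).exists_le_bilinear (X := X) x₀ y₀ hL0
    fun x hx => hL i y₀ hy₀ x hx x₀ hx₀
  choose c hc0 hc using hbil
  set S := ∑ i, c i with hS
  set R := ∑ i, |f i x₀ y₀| with hR
  have hS0 : 0 ≤ S := Finset.sum_nonneg fun i _ => hc0 i
  have hR0 : 0 ≤ R := Finset.sum_nonneg fun i _ => abs_nonneg _
  set M := S + R + n * L + L' with hM
  have hM0 : 0 ≤ M := by positivity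
  have hbound : ∀ i, ∀ x ∈ X, ∀ y ∈ Y, |f i x y| ≤ M * (1 + ‖x - x₀‖) * (1 + ‖y - y₀‖) := by
    intro i x hx y hy
    set a := ‖x - x₀‖
    set b := ‖y - y₀‖
    have ha : 0 ≤ a := norm_nonneg _
    have hb : 0 ≤ b := norm_nonneg _
    set ab := (1 + a) * (1 + b) with hab
    have hab0 : 0 ≤ ab := by positivity
    have hci : ∀ j, f j x y ≤ c j * ab := fun j => by rw [hab, ← mul_assoc]; exact hc j x hx y
    have h1 : f i x y ≤ S * ab := (hci i).trans (mul_le_mul_of_nonneg_right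
      (Finset.single_le_sum (f := c) (fun j _ => hc0 j) (Finset.mem_univ i)) hab0)
    -- The slacks in the upper bounds are nonnegative, so one slack is at most their sum; a lower
    -- bound on `∑ j, f j x y` therefore bounds `f i x y` below.
    have h2 : c i * ab - f i x y ≤ ∑ j, (c j * ab - f j x y) :=
      Finset.single_le_sum (f := fun j => c j * ab - f j x y)
        (fun j _ => by linarith [hci j]) (Finset.mem_univ i)
    rw [Finset.sum_sub_distrib, ← Finset.sum_mul, ← hS] at h2
    have h3 := hL' x hx y₀ hy₀ y hy
    rw [norm_sub_rev] at h3
    have h4 : -(R + n * L * a) ≤ ∑ j, f j x y₀ := by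
      have : ∑ j, (-|f j x₀ y₀| - L * a) ≤ ∑ j, f j x y₀ := Finset.sum_le_sum fun j _ => by
        have := hL j y₀ hy₀ x₀ hx₀ x hx
        rw [norm_sub_rev] at this
        linarith [neg_abs_le (f j x₀ y₀)]
      refine le_trans (le_of_eq ?_) this
      rw [Finset.sum_sub_distrib, Finset.sum_neg_distrib]
      simp only [Finset.sum_const, Finset.card_univ, Fintype.card_fin, nsmul_eq_mul, ← hR]
      ring
    have e1 : 1 ≤ ab := by rw [hab]; nlinarith [mul_nonneg ha hb]
    have e2 : a ≤ ab := by rw [hab]; nlinarith [mul_nonneg ha hb]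
    have e3 : b ≤ ab := by rw [hab]; nlinarith [mul_nonneg ha hb]
    have h5 : R * 1 ≤ R * ab := mul_le_mul_of_nonneg_left e1 hR0
    have h6 : n * L * a ≤ n * L * ab := mul_le_mul_of_nonneg_left e2 (by positivity)
    have h7 : L' * b ≤ L' * ab := mul_le_mul_of_nonneg_left e3 hL0'
    have h8 : 0 ≤ c i * ab := mul_nonneg (hc0 i) hab0
    have h9 : 0 ≤ n * L * a := by positivity
    have h10 : 0 ≤ L' * b := by positivity
    rw [show M * (1 + a) * (1 + b) = S * ab + R * ab + n * L * ab + L' * ab by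
      rw [hM, hab]; ring, abs_le]
    constructor <;> linarith
  refine ⟨(L' + n * M) * (4 / r + 2) * (1 + ‖y₁ - y₀‖), by positivity,
    fun i x hx u hu v hv => ?_⟩
  have hmain := abs_sub_le_mul_norm_of_concave_family (h := fun i => f i x) (Y := Y) (y₀ := y₀)
    (M := M * (1 + ‖x - x₀‖)) (L := L') (r := r)
    (fun i => ((hf i).2 x).subset (Set.subset_univ Y) hY) (by positivity) hr hy₀ hrel
    (fun i y hy => hbound i x hx y hy) hL0' (hL' x hx) hu hv i
  refine hmain.trans (mul_le_mul_of_nonneg_right ?_ (norm_nonneg _))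
  have h1 : L' + n * (M * (1 + ‖x - x₀‖)) ≤ (L' + n * M) * (1 + ‖x - x₀‖) := by
    nlinarith [mul_nonneg hL0' (norm_nonneg (x - x₀))]
  -- Recentring from the relative interior point `y₀` to the given `y₁`.
  have h2 : 1 + ‖v - y₀‖ ≤ (1 + ‖y₁ - y₀‖) * (1 + ‖v - y₁‖) := by
    have := norm_add_le (v - y₁) (y₁ - y₀)
    rw [sub_add_sub_cancel] at this
    nlinarith [mul_nonneg (norm_nonneg (v - y₁)) (norm_nonneg (y₁ - y₀))]
  calc _ ≤ ((L' + n * M) * (1 + ‖x - x₀‖)) * (4 / r + 2) *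
        ((1 + ‖y₁ - y₀‖) * (1 + ‖v - y₁‖)) := by gcongr
    _ = _ := by ring

/-! ### One subnetwork -/

theorem sum_smul_mem {n m : ℕ} {X : Set (RVec m)} (hX : Convex ℝ X) {p : Fin n → ℝ}
    (hp : ∀ i, 0 ≤ p i) (hp1 : ∑ i, p i = 1) {x : Fin n → RVec m} (hx : ∀ i, x i ∈ X) :
    ∑ i, p i • x i ∈ X :=
  hX.sum_mem (fun i _ => hp i) hp1 fun i _ => hx i

/-- Jensen's inequality for the squared distance to a point. -/
theorem norm_sum_smul_sub_sq_le {n m : ℕ} {p : Fin n → ℝ} (hp : ∀ i, 0 ≤ p i)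
    (hp1 : ∑ i, p i = 1) (x : Fin n → RVec m) (z : RVec m) :
    ‖∑ i, p i • x i - z‖ ^ 2 ≤ ∑ i, p i * ‖x i - z‖ ^ 2 := by
  have h1 : ∑ i, p i • x i - z = ∑ i, p i • (x i - z) := by
    simp only [smul_sub, Finset.sum_sub_distrib, ← Finset.sum_smul, hp1, one_smul]
  have h2 : ConvexOn ℝ Set.univ fun v : RVec m => ‖v‖ ^ 2 :=
    (convexOn_norm convex_univ).pow (fun v _ => norm_nonneg v) 2
  rw [h1]
  exact h2.map_sum_le (fun i _ => hp i) hp1 fun i _ => Set.mem_univ _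

section Subnetwork

variable {n m₁ m₂ : ℕ} {X : Set (RVec m₁)} {Y : Set (RVec m₂)}
  {f : Fin n → RVec m₁ → RVec m₂ → ℝ} {A : ℕ → Matrix (Fin n) (Fin n) ℝ} {φ : ℕ → Fin n → ℝ}
  {c L : ℝ} {γ : ℕ → ℝ} {x : ℕ → Fin n → RVec m₁} {u : ℕ → Fin n → RVec m₂}

/-- The projected subgradient iteration of one subnetwork, with information `u k i` about the
decision of the other one. -/
def IsSubgradientIteration (X : Set (RVec m₁)) (f : Fin n → RVec m₁ → RVec m₂ → ℝ)
    (A : ℕ → Matrix (Fin n) (Fin n) ℝ) (α : ℕ → Fin n → ℝ) (u : ℕ → Fin n → RVec m₂)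
    (x : ℕ → Fin n → RVec m₁) : Prop :=
  ∀ k i, ∃ q ∈ convexSubdiff (fun x' => f i x' (u k i)) (∑ j, A k i j • x k j),
    IsProjection X (∑ j, A k i j • x k j - α k i • q) (x (k + 1) i)

/-- The initial states are arbitrary; membership begins with the first projection. -/
theorem IsSubgradientIteration.mem {α : ℕ → Fin n → ℝ}
    (hx : IsSubgradientIteration X f A α u x) {k : ℕ} (hk : 1 ≤ k) (i : Fin n) : x k i ∈ X := by
  obtain ⟨k, rfl⟩ := Nat.exists_eq_add_of_le' hk
  obtain ⟨q, -, hq⟩ := hx k i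
  exact hq.1

/-- Eventually the states move by `O(γ k)` in addition to averaging; hence always. -/
theorem IsSubgradientIteration.exists_norm_sub_le (hX : Convex ℝ X)
    (hx : IsSubgradientIteration X f A (fun k i => γ k / φ (k + 1) i) u x)
    (hA : ∀ k, IsRowStochastic (A k)) (hφ : IsLimitFamily A φ c) (hγ : ∀ k, 0 < γ k)
    (hL : ∀ x ∈ X, ∀ y ∈ Y, ∀ i, ∀ q ∈ convexSubdiff (fun x' => f i x' y) x, ‖q‖ ≤ L)
    (hu : ∀ᶠ k in atTop, ∀ i, u k i ∈ Y) :
    ∃ C, 0 ≤ C ∧ ∀ k i, ‖x (k + 1) i - ∑ j, A k i j • x k j‖ ≤ C * γ k := by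
  refine exists_forall_le_mul_of_eventually (C := L / c) hγ ?_
  filter_upwards [hu, eventually_ge_atTop 1] with k huk hk i
  obtain ⟨q, hq, hp⟩ := hx k i
  have hmem := sum_smul_mem hX ((hA k).1 i) ((hA k).2 i) (hx.mem hk)
  have hqL := hL _ hmem _ (huk i) i q hq
  -- The average already lies in `X`, so the projected point is no farther from it than the
  -- unprojected subgradient step.
  refine (hp.norm_sub_le hX hmem).trans ?_
  have hφp : 0 < φ (k + 1) i := hφ.pos.trans_le (hφ.le _ _)
  rw [sub_sub_cancel_left, norm_neg, norm_smul, Real.norm_of_nonneg (div_pos (hγ k) hφp).le]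
  calc γ k / φ (k + 1) i * ‖q‖ ≤ γ k / c * L :=
        mul_le_mul (div_le_div_of_nonneg_left (hγ k).le hφ.pos (hφ.le _ _)) hqL (norm_nonneg _)
          (div_pos (hγ k) hφ.pos).le
    _ = L / c * γ k := by ring

/-- By `IsLimitFamily.sum_smul` averaging leaves the mean in place, so only the perturbations move
it. -/
theorem norm_mean_succ_sub_mean_le (hφ : IsLimitFamily A φ c) {C : ℝ}
    (hstep : ∀ k i, ‖x (k + 1) i - ∑ j, A k i j • x k j‖ ≤ C * γ k) (k : ℕ) :
    ‖∑ i, φ (k + 1) i • x (k + 1) i - ∑ i, φ k i • x k i‖ ≤ C * γ k := by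
  rw [← hφ.sum_smul k (x k), ← Finset.sum_sub_distrib]
  simp only [← smul_sub]
  calc _ ≤ ∑ i, φ (k + 1) i * (C * γ k) := by
        refine (norm_sum_le _ _).trans (Finset.sum_le_sum fun i _ => ?_)
        rw [norm_smul, Real.norm_of_nonneg (hφ.nonneg _ _)]
        exact mul_le_mul_of_nonneg_left (hstep k i) (hφ.nonneg _ _)
    _ = C * γ k := by rw [← Finset.sum_mul, hφ.sum_eq_one, one_mul]

theorem norm_mean_sub_mean_le (hφ : IsLimitFamily A φ c) {C : ℝ}
    (hstep : ∀ k i, ‖x (k + 1) i - ∑ j, A k i j • x k j‖ ≤ C * γ k) {k t : ℕ} (ht : t ≤ k) :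
    ‖∑ i, φ k i • x k i - ∑ i, φ (k - t) i • x (k - t) i‖ ≤
      ∑ l ∈ Finset.range t, C * γ (k - (l + 1)) := by
  induction t with
  | zero => simp
  | succ t ih =>
    rw [Finset.sum_range_succ]
    have h1 := ih (by omega)
    have h2 := norm_mean_succ_sub_mean_le hφ hstep (k - (t + 1))
    rw [show k - (t + 1) + 1 = k - t by omega] at h2
    refine le_trans ?_ (add_le_add h1 h2)
    exact norm_sub_le_norm_sub_add_norm_sub _ _ _

/-- An average of states at a time at most `T` steps old is close to the current mean. -/
theorem norm_delayed_sub_mean_le (hφ : IsLimitFamily A φ c) {C : ℝ} (hC : 0 ≤ C)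
    (hγ : ∀ k, 0 < γ k)
    (hstep : ∀ k i, ‖x (k + 1) i - ∑ j, A k i j • x k j‖ ≤ C * γ k) {p : Fin n → ℝ}
    (hp : ∀ i, 0 ≤ p i) (hp1 : ∑ i, p i = 1) {s k T : ℕ} (hs : s ≤ k) (hT : k < s + T) :
    ‖∑ i, p i • x s i - ∑ i, φ k i • x k i‖ ≤
      ∑ t ∈ Finset.range (T + 1), (spread (x (k - t)) + C * γ (k - t)) := by
  obtain ⟨t, rfl⟩ := Nat.exists_eq_add_of_le hs
  have h1 := norm_mean_sub_mean_le hφ hstep (Nat.le_add_left t s)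
  rw [Nat.add_sub_cancel] at h1
  have h2 := norm_convexComb_sub_convexComb_le hp (hφ.nonneg s) hp1 (hφ.sum_eq_one s) (x s)
  -- Bounding by the sum over the whole window makes the estimate independent of the actual delay
  -- `t`.
  have h3 : spread (x s) ≤ ∑ l ∈ Finset.range (T + 1), spread (x (s + t - l)) := by
    have := Finset.single_le_sum (f := fun l => spread (x (s + t - l)))
      (fun l _ => spread_nonneg _) (Finset.mem_range.2 (show t < T + 1 by omega))
    simpa using this
  have h4 : ∑ l ∈ Finset.range t, C * γ (s + t - (l + 1)) ≤
      ∑ l ∈ Finset.range (T + 1), C * γ (s + t - l) := by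
    rw [Finset.sum_range_succ']
    have h5 : ∑ l ∈ Finset.range t, C * γ (s + t - (l + 1)) ≤
        ∑ l ∈ Finset.range T, C * γ (s + t - (l + 1)) :=
      Finset.sum_le_sum_of_subset_of_nonneg (Finset.range_mono (by omega))
        fun l _ _ => mul_nonneg hC (hγ _).le
    linarith [mul_nonneg hC (hγ (s + t - 0)).le]
  rw [Finset.sum_add_distrib]
  rw [norm_sub_rev] at h1
  linarith [norm_sub_le_norm_sub_add_norm_sub (∑ i, p i • x s i) (∑ i, φ s i • x s i)
    (∑ i, φ (s + t) i • x (s + t) i)]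

/-- One step of the iteration decreases the weighted squared distance to a point of `X`, up to
second order terms. -/
theorem IsSubgradientIteration.sum_sq_le (hX : Convex ℝ X)
    (hx : IsSubgradientIteration X f A (fun k i => γ k / φ (k + 1) i) u x)
    (hA : ∀ k, IsRowStochastic (A k)) (hφ : IsLimitFamily A φ c) (hγ : ∀ k, 0 < γ k)
    (hL : ∀ x ∈ X, ∀ y ∈ Y, ∀ i, ∀ q ∈ convexSubdiff (fun x' => f i x' y) x, ‖q‖ ≤ L)
    {k : ℕ} (hk : 1 ≤ k) (hu : ∀ i, u k i ∈ Y) {z : RVec m₁} (hz : z ∈ X) :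
    ∑ i, φ (k + 1) i * ‖x (k + 1) i - z‖ ^ 2 ≤ ∑ i, φ k i * ‖x k i - z‖ ^ 2
      - 2 * γ k * ∑ i, (f i (∑ j, A k i j • x k j) (u k i) - f i z (u k i))
      + n * L ^ 2 / c * γ k ^ 2 := by
  have hpt : ∀ i, φ (k + 1) i * ‖x (k + 1) i - z‖ ^ 2 ≤
      φ (k + 1) i * (∑ j, A k i j * ‖x k j - z‖ ^ 2)
      - 2 * γ k * (f i (∑ j, A k i j • x k j) (u k i) - f i z (u k i))
      + L ^ 2 / c * γ k ^ 2 := by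
    intro i
    obtain ⟨q, hq, hp⟩ := hx k i
    have hmem := sum_smul_mem hX ((hA k).1 i) ((hA k).2 i) (hx.mem hk)
    have hqL := hL _ hmem _ (hu i) i q hq
    have hJ := norm_sum_smul_sub_sq_le ((hA k).1 i) ((hA k).2 i) (x k) z
    set w := ∑ j, A k i j • x k j
    have hφp : 0 < φ (k + 1) i := hφ.pos.trans_le (hφ.le _ _)
    set ψ := φ (k + 1) i
    have hsub : f i z (u k i) ≥ f i w (u k i) + inner ℝ (z - w) q := hq z
    have h1 : ‖x (k + 1) i - z‖ ^ 2 ≤ ‖w - (γ k / ψ) • q - z‖ ^ 2 :=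
      pow_le_pow_left₀ (norm_nonneg _) (hp.norm_sub_le hX hz) 2
    have h2 : ‖w - (γ k / ψ) • q - z‖ ^ 2 =
        ‖w - z‖ ^ 2 + 2 * (γ k / ψ) * inner ℝ (z - w) q + (γ k / ψ) ^ 2 * ‖q‖ ^ 2 := by
      rw [show w - (γ k / ψ) • q - z = (w - z) - (γ k / ψ) • q by abel, norm_sub_sq_real,
        inner_smul_right, norm_smul, Real.norm_of_nonneg (div_pos (hγ k) hφp).le, mul_pow,
        ← neg_sub w z, inner_neg_left]
      ring
    have h3 : ‖q‖ ^ 2 ≤ L ^ 2 := pow_le_pow_left₀ (norm_nonneg _) hqL 2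
    have h4 : γ k ^ 2 / ψ * ‖q‖ ^ 2 ≤ γ k ^ 2 / c * L ^ 2 :=
      mul_le_mul (div_le_div_of_nonneg_left (sq_nonneg _) hφ.pos (hφ.le _ _)) h3
        (sq_nonneg _) (div_nonneg (sq_nonneg _) hφ.pos.le)
    -- Multiplication by `ψ` cancels the denominator of the stepsize: the first order term gets the
    -- coefficient `2 * γ k` for every agent.
    calc ψ * ‖x (k + 1) i - z‖ ^ 2
        ≤ ψ * (‖w - z‖ ^ 2 + 2 * (γ k / ψ) * inner ℝ (z - w) q + (γ k / ψ) ^ 2 * ‖q‖ ^ 2) :=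
          mul_le_mul_of_nonneg_left (h1.trans_eq h2) hφp.le
      _ = ψ * ‖w - z‖ ^ 2 + 2 * γ k * inner ℝ (z - w) q + γ k ^ 2 / ψ * ‖q‖ ^ 2 := by
          field_simp
      _ ≤ ψ * (∑ j, A k i j * ‖x k j - z‖ ^ 2) +
          2 * γ k * (f i z (u k i) - f i w (u k i)) + γ k ^ 2 / c * L ^ 2 := by
          have h5 := mul_le_mul_of_nonneg_left hJ hφp.le
          have h6 : inner ℝ (z - w) q ≤ f i z (u k i) - f i w (u k i) := by linarith
          have h7 := mul_le_mul_of_nonneg_left h6 (show 0 ≤ 2 * γ k by linarith [hγ k])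
          linarith
      _ = _ := by ring
  have hsum := Finset.sum_le_sum fun i (_ : i ∈ Finset.univ) => hpt i
  refine hsum.trans_eq ?_
  rw [Finset.sum_add_distrib, Finset.sum_sub_distrib, ← Finset.mul_sum]
  have h8 := hφ.sum_smul k fun j => ‖x k j - z‖ ^ 2
  simp only [smul_eq_mul] at h8
  rw [h8]
  simp only [Finset.sum_const, Finset.card_univ, Fintype.card_fin, nsmul_eq_mul]
  ring

/-- The decrease in terms of the sum objective at the means. -/
theorem IsSubgradientIteration.exists_descent (hX : Convex ℝ X) (hY : Convex ℝ Y)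
    (hf : ∀ i, ConvexConcave (f i))
    (hx : IsSubgradientIteration X f A (fun k i => γ k / φ (k + 1) i) u x)
    (hA : ∀ k, IsRowStochastic (A k)) (hφ : IsLimitFamily A φ c) (hγ : ∀ k, 0 < γ k)
    (hL0 : 0 ≤ L)
    (hL : ∀ x ∈ X, ∀ y ∈ Y, ∀ i, ∀ q ∈ convexSubdiff (fun x' => f i x' y) x, ‖q‖ ≤ L)
    {L' : ℝ} (hL0' : 0 ≤ L')
    (hL' : ∀ x ∈ X, ∀ y ∈ Y, ∀ y' ∈ Y, ∑ i, f i x y - ∑ i, f i x y' ≤ L' * ‖y - y'‖)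
    {v : ℕ → RVec m₂} {δ : ℕ → ℝ}
    (hu : ∀ᶠ k in atTop, v k ∈ Y ∧ ∀ i, u k i ∈ Y ∧ ‖u k i - v k‖ ≤ δ k)
    (hδ : ∀ k, 0 ≤ δ k)
    {xs : RVec m₁} {ys : RVec m₂} (hxs : xs ∈ X) (hys : ys ∈ Y) :
    ∃ C, 0 ≤ C ∧ ∀ᶠ k in atTop,
      ∑ i, φ (k + 1) i * ‖x (k + 1) i - xs‖ ^ 2 ≤ ∑ i, φ k i * ‖x k i - xs‖ ^ 2
        - 2 * γ k * (∑ i, f i (∑ j, φ k j • x k j) (v k) - ∑ i, f i xs (v k))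
        + C * (γ k * (spread (x k) + δ k)) *
          ((1 + ‖∑ j, φ k j • x k j - xs‖) * (1 + ‖v k - ys‖))
        + C * γ k ^ 2 := by
  have hLip : ∀ i, ∀ y ∈ Y, ∀ x ∈ X, ∀ x' ∈ X, f i x y - f i x' y ≤ L * ‖x - x'‖ :=
    fun i y hy x hx x' _ =>
      sub_le_of_convexSubdiff_bounded ((hf i).1 y) (fun z hz => hL z hz y hy i) hx x'
  obtain ⟨K, hK0, hK⟩ :=
    exists_abs_sub_le_of_convexConcave_family hY hf hL0 hL0' hLip hL' hxs hys
  have hcp := hφ.pos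
  refine ⟨2 * n * (L + 2 * K) + n * L ^ 2 / c, by positivity, ?_⟩
  filter_upwards [hu, eventually_ge_atTop 1] with k huk hk
  obtain ⟨hvk, huk⟩ := huk
  have hmain := hx.sum_sq_le hX hA hφ hγ hL hk (fun i => (huk i).1) hxs
  have hmean := sum_smul_mem hX (hφ.nonneg k) (hφ.sum_eq_one k) (hx.mem hk)
  have hhat : ∀ i, ‖∑ j, φ k j • x k j - ∑ j, A k i j • x k j‖ ≤ spread (x k) := fun i =>
    norm_convexComb_sub_convexComb_le (hφ.nonneg k) ((hA k).1 i) (hφ.sum_eq_one k) ((hA k).2 i) _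
  set xm := ∑ j, φ k j • x k j
  set W := (1 + ‖xm - xs‖) * (1 + ‖v k - ys‖) with hW
  have hW1 : 1 ≤ W := by
    rw [hW]
    nlinarith [mul_nonneg (norm_nonneg (xm - xs)) (norm_nonneg (v k - ys)),
      norm_nonneg (xm - xs), norm_nonneg (v k - ys)]
  have hW2 : 1 + ‖v k - ys‖ ≤ W := by
    rw [hW]
    nlinarith [mul_nonneg (norm_nonneg (xm - xs)) (norm_nonneg (v k - ys)),
      norm_nonneg (xm - xs)]
  have hs0 := spread_nonneg (x k)
  have hδk := hδ k
  -- Three replacements: the local average by the mean in the first argument, at cost `L`, and `u k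
  -- i` by `v k` in the second argument, at the mean and at `xs`, at cost `K` times the growth
  -- factor.
  have hterm : ∀ i, f i xm (v k) - f i xs (v k) - (L + 2 * K) * (spread (x k) + δ k) * W ≤
      f i (∑ j, A k i j • x k j) (u k i) - f i xs (u k i) := by
    intro i
    obtain ⟨hui, hud⟩ := huk i
    have hhi := sum_smul_mem hX ((hA k).1 i) ((hA k).2 i) (hx.mem hk)
    have h1 := (hLip i _ hui _ hmean _ hhi).trans (mul_le_mul_of_nonneg_left (hhat i) hL0)
    have h2 := (abs_le.1 (hK i xm hmean _ hui _ hvk)).1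
    have h3 := (abs_le.1 (hK i xs hxs _ hui _ hvk)).2
    rw [← hW] at h2
    rw [sub_self, norm_zero, add_zero, one_mul] at h3
    have h4 : K * W * ‖u k i - v k‖ ≤ K * W * δ k :=
      mul_le_mul_of_nonneg_left hud (by positivity)
    have h5 : K * (1 + ‖v k - ys‖) * ‖u k i - v k‖ ≤ K * W * δ k :=
      mul_le_mul (mul_le_mul_of_nonneg_left hW2 hK0) hud (norm_nonneg _) (by positivity)
    have h6 : L * spread (x k) ≤ L * spread (x k) * W :=
      le_mul_of_one_le_right (by positivity) hW1
    have h7 : 0 ≤ L * δ k * W := by positivity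
    have h8 : 0 ≤ K * spread (x k) * W := by positivity
    nlinarith
  have hsum := Finset.sum_le_sum fun i (_ : i ∈ Finset.univ) => hterm i
  rw [Finset.sum_sub_distrib, Finset.sum_sub_distrib] at hsum
  simp only [Finset.sum_const, Finset.card_univ, Fintype.card_fin, nsmul_eq_mul] at hsum
  have h9 := mul_le_mul_of_nonneg_left hsum (show 0 ≤ 2 * γ k by linarith [hγ k])
  have h10 : 0 ≤ n * L ^ 2 / c * (γ k * (spread (x k) + δ k)) * W := by
    have := hγ k
    positivity
  have h11 : 0 ≤ 2 * n * (L + 2 * K) * γ k ^ 2 := by positivity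
  nlinarith

end Subnetwork

/-- Eventually, the last contact is recent. -/
theorem exists_recent_isGreatest {P : ℕ → Prop} {T k : ℕ} (hk : T ≤ k)
    (hP : ∀ k, ∃ s, k ≤ s ∧ s < k + T ∧ P s) :
    ∃ s, 1 ≤ s ∧ s ≤ k ∧ k < s + T ∧ P s ∧ IsGreatest {t | t ≤ k ∧ P t} s := by
  -- This window ends at `k` inclusive, and `T ≤ k` makes it start at time `1` or later, when the
  -- states already lie in the constraint sets.
  obtain ⟨s₀, h1, h2, h3⟩ := hP (k + 1 - T)
  have hne : {t | t ≤ k ∧ P t}.Nonempty := ⟨s₀, by omega, h3⟩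
  have hbdd : BddAbove {t | t ≤ k ∧ P t} := ⟨k, fun t ht => ht.1⟩
  have hmem := Nat.sSup_mem hne hbdd
  have hle : s₀ ≤ sSup {t | t ≤ k ∧ P t} := le_csSup hbdd ⟨by omega, h3⟩
  exact ⟨_, by omega, hmem.1, by omega, hmem.2, hmem, fun t ht => le_csSup hbdd ht⟩

/-! ### The network -/

/-- Limit vectors exist for uniformly jointly strongly connected sequences of stochastic matrices
with uniformly positive weights. -/
theorem UJSC.exists_isLimitFamily {n : ℕ} (hn : 0 < n) {A : ℕ → Matrix (Fin n) (Fin n) ℝ}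
    (hA : ∀ k, IsRowStochastic (A k)) {η : ℝ} (hη0 : 0 < η) (hη1 : η ≤ 1)
    (hdiag : ∀ k i, η ≤ A k i i) {E : ℕ → Fin n → Fin n → Prop}
    (harc : ∀ k i j, E k j i → η ≤ A k i j) (hE : UJSC E) :
    ∃ (φ : ℕ → Fin n → ℝ) (c : ℝ) (B : ℕ), c ≤ 1 ∧ (∀ s i j, c ≤ blockProd A s B i j) ∧
      IsLimitFamily A φ c ∧ ∀ s, IsLimitVector A s (φ s) := by
  obtain ⟨T, -, hT⟩ := hE
  have hc := pow_le_blockProd hA hη0.le hdiag harc hT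
  have hc1 : η ^ (n * T) ≤ 1 := pow_le_one₀ hη0.le hη1
  obtain ⟨φ, h1, h2⟩ := _root_.exists_isLimitFamily hn hA (pow_pos hη0 _) hc1 hc
  exact ⟨φ, _, _, hc1, hc, h1, h2⟩

/-- After the first window, the information is a recent average of states. -/
theorem exists_recent_average {n n' m : ℕ} {contact : ℕ → Fin n → Prop}
    {M : ℕ → Matrix (Fin n) (Fin n') ℝ} (hM0 : ∀ k i j, 0 ≤ M k i j)
    (hM1 : ∀ k i, contact k i → ∑ j, M k i j = 1) {T : ℕ}
    (hcontact : ∀ k i, ∃ s, k ≤ s ∧ s < k + T ∧ contact s i) {u : ℕ → Fin n → RVec m}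
    {y : ℕ → Fin n' → RVec m}
    (hu : ∀ k i s, IsGreatest {t | t ≤ k ∧ contact t i} s → u k i = ∑ j, M s i j • y s j)
    {k : ℕ} (hk : T ≤ k) (i : Fin n) :
    ∃ (s : ℕ) (p : Fin n' → ℝ), 1 ≤ s ∧ s ≤ k ∧ k < s + T ∧ (∀ j, 0 ≤ p j) ∧ ∑ j, p j = 1 ∧
      u k i = ∑ j, p j • y s j := by
  obtain ⟨s, h1, h2, h3, h4, h5⟩ := exists_recent_isGreatest (P := fun t => contact t i) hk
    fun k => hcontact k i
  exact ⟨s, M s i, h1, h2, h3, hM0 s i, hM1 s i h4, hu k i s h5⟩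

/-- The error bound for information that is at most `T` steps old is summable against `γ`. -/
theorem summable_mul_delayed_error {γ d : ℕ → ℝ} (hγ : ∀ k, 0 < γ k) (hanti : Antitone γ)
    (hsq : Summable fun k => γ k ^ 2) (hd : ∀ k, 0 ≤ d k) (hs : Summable fun k => γ k * d k)
    {C : ℝ} (hC : 0 ≤ C) (T : ℕ) :
    Summable fun k => γ k * ∑ t ∈ Finset.range T, (d (k - t) + C * γ (k - t)) := by
  simp only [Finset.mul_sum]
  refine summable_sum fun t _ => ?_
  refine summable_mul_delay (u := fun k => d k + C * γ k) (fun k => (hγ k).le) hanti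
    (fun k => add_nonneg (hd k) (mul_nonneg hC (hγ k).le)) ?_ t
  refine (hs.add (hsq.mul_left C)).congr fun k => ?_
  ring

/-! ### From the descent inequality to convergence -/

/-- A perturbed descent inequality with summable perturbations: the Lyapunov function converges, and
the gap and the perturbations are simultaneously small at arbitrarily late times. -/
theorem tendsto_and_frequently_of_descent {V gap e γ : ℕ → ℝ} {C : ℝ} (hV : ∀ k, 0 ≤ V k)
    (hγ : ∀ k, 0 < γ k) (hC : 0 ≤ C) (he : ∀ k, 0 ≤ e k)
    (hdiv : Tendsto (fun k => ∑ s ∈ Finset.range k, γ s) atTop atTop)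
    (hsq : Summable fun k => γ k ^ 2) (hse : Summable fun k => γ k * e k)
    (hgap : ∀ᶠ k in atTop, 0 ≤ gap k)
    (h : ∀ᶠ k in atTop, V (k + 1) ≤
      V k - 2 * γ k * gap k + C * (γ k * e k) * (1 + V k) + C * γ k ^ 2) :
    (∃ l, Tendsto V atTop (𝓝 l)) ∧ ∀ ε > 0, ∃ᶠ k in atTop, gap k + e k < ε := by
  obtain ⟨K, hK⟩ := eventually_atTop.1 (hgap.and h)
  have hse' := (summable_nat_add_iff K).2 hse
  have hsq' := (summable_nat_add_iff K).2 hsq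
  -- The factor `1 + V k` splits the error into a multiplicative part `a` and an additive part
  -- inside `c`.
  obtain ⟨⟨l, hl⟩, hb⟩ := tendsto_and_summable_of_almost_antitone (V := fun k => V (k + K))
    (a := fun k => C * (γ (k + K) * e (k + K))) (b := fun k => 2 * γ (k + K) * gap (k + K))
    (c := fun k => C * (γ (k + K) * e (k + K)) + C * γ (k + K) ^ 2)
    (fun k => hV _) (fun k => mul_nonneg hC (mul_nonneg (hγ _).le (he _)))
    (fun k => mul_nonneg (by linarith [hγ (k + K)]) (hK _ (Nat.le_add_left K k)).1)
    (fun k => add_nonneg (mul_nonneg hC (mul_nonneg (hγ _).le (he _))) (by positivity))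
    (hse'.mul_left C) ((hse'.mul_left C).add (hsq'.mul_left C))
    (fun k => by
      have := (hK _ (Nat.le_add_left K k)).2
      rw [show k + 1 + K = k + K + 1 by omega]
      linarith)
  refine ⟨⟨l, (tendsto_add_atTop_iff_nat K).1 hl⟩, fun ε hε => ?_⟩
  refine frequently_lt_of_summable_mul hγ hdiv ?_ hε
  rw [← summable_nat_add_iff K]
  refine ((hb.mul_left (1 / 2)).add hse').congr fun k => ?_
  ring

/-- Uniform weights suffice, because a positive factor does not change saddle points. -/
theorem isSaddlePoint_sum_of_saddleExistence {n m₁ m₂ : ℕ} (hn : 0 < n) {X : Set (RVec m₁)}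
    {Y : Set (RVec m₂)} {f : Fin n → RVec m₁ → RVec m₂ → ℝ} (h : SaddleExistence X Y f) :
    ∃ xs ys, IsSaddlePoint X Y (fun x y => ∑ i, f i x y) xs ys := by
  have hn' : (0 : ℝ) < n := by exact_mod_cast hn
  obtain ⟨xs, ys, hxs, hys, hs⟩ := h (fun _ => (n : ℝ)⁻¹) (fun _ => by positivity) (by
    simp [hn'.ne'])
  refine ⟨xs, ys, hxs, hys, fun x hx y hy => ?_⟩
  have := hs x hx y hy
  simp only [← Finset.mul_sum] at this
  exact ⟨le_of_mul_le_mul_left this.1 (by positivity), le_of_mul_le_mul_left this.2 (by positivity)⟩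

/-- A sequence in a closed set along which a continuous strictly convex function tends to its
minimum converges to the minimizer, if it converges at all. -/
theorem eq_of_tendsto_of_strictConvexOn {m : ℕ} {X : Set (RVec m)} (hXc : IsClosed X)
    {F : RVec m → ℝ} (hF : Continuous F) (hs : StrictConvexOn ℝ X F) {xs a : RVec m} (hxs : xs ∈ X)
    (hmin : ∀ x ∈ X, F xs ≤ F x) {z : ℕ → RVec m} (hz : ∀ k, z k ∈ X)
    (hza : Tendsto z atTop (𝓝 a)) {r : ℕ → ℝ} (hr : Tendsto r atTop (𝓝 0))
    (hle : ∀ k, F (z k) ≤ F xs + r k) : a = xs := by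
  have ha : a ∈ X := hXc.mem_of_tendsto hza (Eventually.of_forall hz)
  have hFa : F a ≤ F xs := by
    refine le_of_tendsto_of_tendsto' ((hF.tendsto a).comp hza) ?_ hle
    simpa using tendsto_const_nhds.add hr
  exact hs.eq_of_isMinOn (fun x hx => hFa.trans (hmin x hx)) (fun x hx => hmin x hx) ha hxs

theorem sum_mul_norm_sub_sq_le {n m : ℕ} {p : Fin n → ℝ} (hp : ∀ i, 0 ≤ p i) (hp1 : ∑ i, p i = 1)
    (x : Fin n → RVec m) (z : RVec m) :
    ∑ i, p i * ‖x i - z‖ ^ 2 ≤ (spread x + ‖∑ i, p i • x i - z‖) ^ 2 := by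
  have h : ∀ i, ‖x i - z‖ ≤ spread x + ‖∑ i, p i • x i - z‖ := fun i => by
    have h1 := norm_convexComb_sub_convexComb_le (IsRowStochastic.one.1 i) hp
      (IsRowStochastic.one.2 i) hp1 x
    have h2 : ∑ j, (1 : Matrix (Fin n) (Fin n) ℝ) i j • x j = x i := by simp [Matrix.one_apply]
    rw [h2] at h1
    exact (norm_sub_le_norm_sub_add_norm_sub _ (∑ i, p i • x i) _).trans (by gcongr)
  calc _ ≤ ∑ i, p i * (spread x + ‖∑ i, p i • x i - z‖) ^ 2 :=
        Finset.sum_le_sum fun i _ => mul_le_mul_of_nonneg_left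
          (pow_le_pow_left₀ (norm_nonneg _) (h i) 2) (hp i)
    _ = _ := by rw [← Finset.sum_mul, hp1, one_mul]

theorem tendsto_of_sum_mul_norm_sub_sq {n m : ℕ} {p : ℕ → Fin n → ℝ} {c : ℝ} (hc : 0 < c)
    (hp : ∀ k i, c ≤ p k i) {x : ℕ → Fin n → RVec m} {z : RVec m}
    (h : Tendsto (fun k => ∑ i, p k i * ‖x k i - z‖ ^ 2) atTop (𝓝 0)) (i : Fin n) :
    Tendsto (fun k => x k i) atTop (𝓝 z) := by
  rw [tendsto_iff_norm_sub_tendsto_zero]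
  have h1 : Tendsto (fun k => ‖x k i - z‖ ^ 2) atTop (𝓝 0) := by
    refine squeeze_zero (fun k => sq_nonneg _) (fun k => ?_) (by simpa using h.const_mul c⁻¹)
    rw [inv_mul_eq_div, le_div_iff₀ hc, mul_comm]
    refine (mul_le_mul_of_nonneg_right (hp k i) (sq_nonneg _)).trans ?_
    exact Finset.single_le_sum (f := fun i => p k i * ‖x k i - z‖ ^ 2)
      (fun i _ => mul_nonneg (hc.le.trans (hp k i)) (sq_nonneg _)) (Finset.mem_univ i)
  simpa using h1.sqrt

/-- From simultaneous smallness of gap and spreads at arbitrarily late times to convergence of all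
states to the saddle point. -/
theorem tendsto_saddlePoint {n₁ n₂ m₁ m₂ : ℕ} {X : Set (RVec m₁)} {Y : Set (RVec m₂)}
    (hXc : IsClosed X) (hYc : IsClosed Y) {U : RVec m₁ → RVec m₂ → ℝ}
    (hU : StrictConvexConcaveOn X Y U) (hcx : ∀ y, Continuous fun x => U x y)
    (hcy : ∀ x, Continuous (U x)) {xs : RVec m₁} {ys : RVec m₂} (hs : IsSaddlePoint X Y U xs ys)
    {x : ℕ → Fin n₁ → RVec m₁} {y : ℕ → Fin n₂ → RVec m₂} {p : ℕ → Fin n₁ → ℝ}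
    {q : ℕ → Fin n₂ → ℝ} {c d : ℝ} (hc : 0 < c) (hd : 0 < d) (hpc : ∀ k i, c ≤ p k i)
    (hqd : ∀ k i, d ≤ q k i) (hp1 : ∀ k, ∑ i, p k i = 1) (hq1 : ∀ k, ∑ i, q k i = 1)
    (hX : ∀ᶠ k in atTop, ∑ i, p k i • x k i ∈ X) (hY : ∀ᶠ k in atTop, ∑ i, q k i • y k i ∈ Y)
    {l : ℝ} (hV : Tendsto (fun k => ∑ i, p k i * ‖x k i - xs‖ ^ 2 + ∑ i, q k i * ‖y k i - ys‖ ^ 2)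
      atTop (𝓝 l))
    (hfreq : ∀ ε > 0, ∃ᶠ k in atTop,
      U (∑ i, p k i • x k i) ys - U xs (∑ i, q k i • y k i) + (spread (x k) + spread (y k)) < ε) :
    (∀ i, Tendsto (fun k => x k i) atTop (𝓝 xs)) ∧
      ∀ i, Tendsto (fun k => y k i) atTop (𝓝 ys) := by
  obtain ⟨hxs, hys, hsad⟩ := hs
  have hp0 : ∀ k i, 0 ≤ p k i := fun k i => hc.le.trans (hpc k i)
  have hq0 : ∀ k i, 0 ≤ q k i := fun k i => hd.le.trans (hqd k i)
  set xm : ℕ → RVec m₁ := fun k => ∑ i, p k i • x k i with hxm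
  set ym : ℕ → RVec m₂ := fun k => ∑ i, q k i • y k i with hym
  have hVx0 : ∀ k, 0 ≤ ∑ i, p k i * ‖x k i - xs‖ ^ 2 := fun k =>
    Finset.sum_nonneg fun i _ => mul_nonneg (hp0 k i) (sq_nonneg _)
  have hVy0 : ∀ k, 0 ≤ ∑ i, q k i * ‖y k i - ys‖ ^ 2 := fun k =>
    Finset.sum_nonneg fun i _ => mul_nonneg (hq0 k i) (sq_nonneg _)
  set V : ℕ → ℝ := fun k =>
    ∑ i, p k i * ‖x k i - xs‖ ^ 2 + ∑ i, q k i * ‖y k i - ys‖ ^ 2 with hVdef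
  -- A subsequence along which gap and spreads are below `1 / (N + 1)`; boundedness of `V` then
  -- provides a further one along which both means converge.
  obtain ⟨ψ, hψ, hψP⟩ := extraction_forall_of_frequently
    (P := fun (N : ℕ) k => (U (xm k) ys - U xs (ym k) + (spread (x k) + spread (y k)) <
      1 / ((N : ℝ) + 1)) ∧ xm k ∈ X ∧ ym k ∈ Y)
    fun N => (hfreq _ Nat.one_div_pos_of_nat).and_eventually (hX.and hY)
  have hVbdd : ∃ R, ∀ k, V k ≤ R := by
    obtain ⟨R, hR⟩ := hV.bddAbove_range
    exact ⟨R, fun k => hR ⟨k, rfl⟩⟩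
  obtain ⟨R, hR⟩ := hVbdd
  have hxmR : ∀ k, ‖xm k - xs‖ ^ 2 ≤ R := fun k =>
    (norm_sum_smul_sub_sq_le (hp0 k) (hp1 k) (x k) xs).trans (by linarith [hR k, hVy0 k])
  have hymR : ∀ k, ‖ym k - ys‖ ^ 2 ≤ R := fun k =>
    (norm_sum_smul_sub_sq_le (hq0 k) (hq1 k) (y k) ys).trans (by linarith [hR k, hVx0 k])
  have hmemball : ∀ k, (xm k, ym k) ∈ Metric.closedBall xs (√R) ×ˢ Metric.closedBall ys (√R) :=
    fun k => ⟨by rw [mem_closedBall_iff_norm]; exact Real.le_sqrt_of_sq_le (hxmR k),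
      by rw [mem_closedBall_iff_norm]; exact Real.le_sqrt_of_sq_le (hymR k)⟩
  obtain ⟨⟨a, b⟩, -, θ, hθ, hlim⟩ := tendsto_subseq_of_bounded
    ((Metric.isBounded_closedBall.prod Metric.isBounded_closedBall))
    (x := fun k => (xm (ψ k), ym (ψ k))) fun k => hmemball (ψ k)
  have hlimx : Tendsto (fun k => xm (ψ (θ k))) atTop (𝓝 a) :=
    (continuous_fst.tendsto _).comp hlim
  have hlimy : Tendsto (fun k => ym (ψ (θ k))) atTop (𝓝 b) :=
    (continuous_snd.tendsto _).comp hlim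
  have hr : Tendsto (fun k => 1 / ((θ k : ℝ) + 1)) atTop (𝓝 0) :=
    (tendsto_one_div_add_atTop_nhds_zero_nat (𝕜 := ℝ)).comp hθ.tendsto_atTop
  have hP := fun k => hψP (θ k)
  -- The gap is the sum of the nonnegative terms `U(x̄, ys) - U(xs, ys)` and `U(xs, ys) - U(xs, ȳ)`,
  -- so both vanish in the limit.
  have hax : a = xs := by
    refine eq_of_tendsto_of_strictConvexOn hXc (hcx ys) (hU.1 ys hys) hxs
      (fun x hx => (hsad x hx ys hys).2) (fun k => (hP k).2.1) hlimx hr fun k => ?_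
    have h1 := (hP k).1
    have h2 := (hsad xs hxs _ (hP k).2.2).1
    linarith [spread_nonneg (x (ψ (θ k))), spread_nonneg (y (ψ (θ k)))]
  have hby : b = ys := by
    refine eq_of_tendsto_of_strictConvexOn hYc (hcy xs).neg (hU.2 xs hxs).neg hys
      (fun y hy => neg_le_neg (hsad xs hxs y hy).1) (fun k => (hP k).2.2) hlimy hr fun k => ?_
    have h1 := (hP k).1
    have h2 := (hsad _ (hP k).2.1 ys hys).2
    simp only [Pi.neg_apply]
    linarith [spread_nonneg (x (ψ (θ k))), spread_nonneg (y (ψ (θ k)))]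
  have hgap0 : ∀ k, 0 ≤ U (xm (ψ (θ k))) ys - U xs (ym (ψ (θ k))) := fun k => by
    have h1 := (hsad _ (hP k).2.1 ys hys).2
    have h2 := (hsad xs hxs _ (hP k).2.2).1
    linarith
  have hsx : Tendsto (fun k => spread (x (ψ (θ k)))) atTop (𝓝 0) :=
    squeeze_zero (fun k => spread_nonneg _) (fun k => by
      linarith [(hP k).1, hgap0 k, spread_nonneg (y (ψ (θ k)))]) hr
  have hsy : Tendsto (fun k => spread (y (ψ (θ k)))) atTop (𝓝 0) :=
    squeeze_zero (fun k => spread_nonneg _) (fun k => by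
      linarith [(hP k).1, hgap0 k, spread_nonneg (x (ψ (θ k)))]) hr
  subst hax hby
  have hVsub : Tendsto (fun k => V (ψ (θ k))) atTop (𝓝 0) := by
    refine squeeze_zero (fun k => add_nonneg (hVx0 _) (hVy0 _))
      (fun k => add_le_add (sum_mul_norm_sub_sq_le (hp0 _) (hp1 _) _ _)
        (sum_mul_norm_sub_sq_le (hq0 _) (hq1 _) _ _)) ?_
    have h1 := tendsto_iff_norm_sub_tendsto_zero.1 hlimx
    have h2 := tendsto_iff_norm_sub_tendsto_zero.1 hlimy
    simpa using ((hsx.add h1).pow 2).add ((hsy.add h2).pow 2)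
  -- The whole sequence `V` converges, so the subsequence determines its limit.
  have hl : l = 0 :=
    tendsto_nhds_unique (hV.comp (hψ.tendsto_atTop.comp hθ.tendsto_atTop)) hVsub
  subst hl
  refine ⟨tendsto_of_sum_mul_norm_sub_sq hc hpc ?_, tendsto_of_sum_mul_norm_sub_sq hd hqd ?_⟩
  · exact squeeze_zero hVx0 (fun k => by linarith [hVy0 k]) hV
  · exact squeeze_zero hVy0 (fun k => by linarith [hVx0 k]) hV

/-! ### Harmonic stepsizes and tools for coupling the subnetworks -/

theorem baseStepsize_one_div : BaseStepsize fun k => 1 / ((k : ℝ) + 1) := by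
  have h0 := tendsto_one_div_add_atTop_nhds_zero_nat (𝕜 := ℝ)
  refine ⟨fun k => Nat.one_div_pos_of_nat, ?_, ?_, Real.tendsto_sum_range_one_div_nat_succ_atTop,
    ?_⟩
  -- The product is at most the Cesàro mean of `γ`, which tends to zero with `γ`; at `k = 0` both
  -- sides vanish.
  · refine squeeze_zero (fun k => by positivity) (fun k => ?_) h0.cesaro
    rcases Nat.eq_zero_or_pos k with rfl | hk
    · simp
    · refine mul_le_mul_of_nonneg_right ?_ (Finset.sum_nonneg fun i _ => by positivity)
      have : (0 : ℝ) < k := by exact_mod_cast hk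
      simp only [one_div]
      exact inv_anti₀ this (by linarith)
  · intro a b hab
    have : (a : ℝ) ≤ b := by exact_mod_cast hab
    simp only
    gcongr
  · have h := (summable_nat_add_iff 1).2 (Real.summable_one_div_nat_pow.2 (one_lt_two))
    refine h.congr fun k => ?_
    push_cast
    rw [one_div_pow]

/-- Turns the maximizing subnetwork into a minimizing one, so that a single analysis serves both. -/
theorem ConvexConcave.neg_swap {m₁ m₂ : ℕ} {φ : RVec m₁ → RVec m₂ → ℝ} (h : ConvexConcave φ) :
    ConvexConcave fun y x => -φ x y :=
  ⟨fun x => (h.2 x).neg, fun y => (h.1 y).neg⟩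

theorem ConvexConcave.continuous_left {m₁ m₂ : ℕ} {φ : RVec m₁ → RVec m₂ → ℝ}
    (h : ConvexConcave φ) (y : RVec m₂) : Continuous fun x => φ x y := by
  rw [← continuousOn_univ]
  exact (h.1 y).continuousOn isOpen_univ

theorem ConvexConcave.continuous_right {m₁ m₂ : ℕ} {φ : RVec m₁ → RVec m₂ → ℝ}
    (h : ConvexConcave φ) (x : RVec m₁) : Continuous (φ x) := by
  rw [← continuousOn_univ]
  exact (h.2 x).continuousOn isOpen_univ

theorem one_add_mul_one_add_le {a b s : ℝ} (h : a ^ 2 + b ^ 2 ≤ s) :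
    (1 + a) * (1 + b) ≤ 2 * (1 + s) := by
  nlinarith [sq_nonneg (a - b), sq_nonneg (a - 1), sq_nonneg (b - 1)]

/-- If the objectives of one subnetwork have bounded subgradients in their own variable, then their
sum is Lipschitz in that variable. -/
theorem sum_sub_sum_le_of_convexSubdiff_bounded {n m₁ m₂ : ℕ} {X : Set (RVec m₁)}
    {Y : Set (RVec m₂)} {f : Fin n → RVec m₁ → RVec m₂ → ℝ} (hf : ∀ i, ConvexConcave (f i)) {L : ℝ}
    (hL : ∀ x ∈ X, ∀ y ∈ Y, ∀ i, ∀ q ∈ convexSubdiff (fun x' => f i x' y) x, ‖q‖ ≤ L)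
    {y : RVec m₂} (hy : y ∈ Y) {x : RVec m₁} (hx : x ∈ X) (x' : RVec m₁) :
    ∑ i, f i x y - ∑ i, f i x' y ≤ n * L * ‖x - x'‖ := by
  rw [← Finset.sum_sub_distrib]
  refine (Finset.sum_le_sum fun i _ => sub_le_of_convexSubdiff_bounded ((hf i).1 y)
    (fun z hz => hL z hz y hy i) hx x').trans_eq ?_
  simp only [Finset.sum_const, Finset.card_univ, Fintype.card_fin, nsmul_eq_mul]
  ring

/-! ### The coupled iterations and the main theorem -/

/-- Two coupled projected subgradient iterations, each driven by recent averages of the states of the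
other one, converge to a saddle point. -/
theorem tendsto_saddlePoint_of_iterations {n₁ n₂ m₁ m₂ : ℕ} {X : Set (RVec m₁)}
    {Y : Set (RVec m₂)} (hXc : IsClosed X) (hX : Convex ℝ X) (hYc : IsClosed Y) (hY : Convex ℝ Y)
    {f : Fin n₁ → RVec m₁ → RVec m₂ → ℝ} {g : Fin n₂ → RVec m₂ → RVec m₁ → ℝ}
    (hf : ∀ i, ConvexConcave (f i)) (hg : ∀ i, ConvexConcave (g i))
    (hfg : ∀ x ∈ X, ∀ y ∈ Y, ∑ i, f i x y = -∑ i, g i y x)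
    {L : ℝ} (hL0 : 0 ≤ L)
    (hLf : ∀ x ∈ X, ∀ y ∈ Y, ∀ i, ∀ q ∈ convexSubdiff (fun x' => f i x' y) x, ‖q‖ ≤ L)
    (hLg : ∀ y ∈ Y, ∀ x ∈ X, ∀ i, ∀ q ∈ convexSubdiff (fun y' => g i y' x) y, ‖q‖ ≤ L)
    (hU : StrictConvexConcaveOn X Y (fun x y => ∑ i, f i x y))
    {xs : RVec m₁} {ys : RVec m₂} (hs : IsSaddlePoint X Y (fun x y => ∑ i, f i x y) xs ys)
    {A₁ : ℕ → Matrix (Fin n₁) (Fin n₁) ℝ} {A₂ : ℕ → Matrix (Fin n₂) (Fin n₂) ℝ}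
    (hA₁ : ∀ k, IsRowStochastic (A₁ k)) (hA₂ : ∀ k, IsRowStochastic (A₂ k))
    {φ₁ : ℕ → Fin n₁ → ℝ} {φ₂ : ℕ → Fin n₂ → ℝ} {c₁ c₂ : ℝ} {B₁ B₂ : ℕ}
    (hφ₁ : IsLimitFamily A₁ φ₁ c₁) (hφ₂ : IsLimitFamily A₂ φ₂ c₂) (hc₁ : c₁ ≤ 1) (hc₂ : c₂ ≤ 1)
    (hB₁ : ∀ s i j, c₁ ≤ blockProd A₁ s B₁ i j) (hB₂ : ∀ s i j, c₂ ≤ blockProd A₂ s B₂ i j)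
    {γ : ℕ → ℝ} (hγ : BaseStepsize γ)
    {x : ℕ → Fin n₁ → RVec m₁} {y : ℕ → Fin n₂ → RVec m₂}
    {u : ℕ → Fin n₁ → RVec m₂} {v : ℕ → Fin n₂ → RVec m₁}
    (hx : IsSubgradientIteration X f A₁ (fun k i => γ k / φ₁ (k + 1) i) u x)
    (hy : IsSubgradientIteration Y g A₂ (fun k i => γ k / φ₂ (k + 1) i) v y) {T : ℕ}
    (hu : ∀ k, T ≤ k → ∀ i, ∃ (s : ℕ) (p : Fin n₂ → ℝ), 1 ≤ s ∧ s ≤ k ∧ k < s + T ∧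
      (∀ j, 0 ≤ p j) ∧ ∑ j, p j = 1 ∧ u k i = ∑ j, p j • y s j)
    (hv : ∀ k, T ≤ k → ∀ i, ∃ (s : ℕ) (p : Fin n₁ → ℝ), 1 ≤ s ∧ s ≤ k ∧ k < s + T ∧
      (∀ j, 0 ≤ p j) ∧ ∑ j, p j = 1 ∧ v k i = ∑ j, p j • x s j) :
    (∀ i, Tendsto (fun k => x k i) atTop (𝓝 xs)) ∧
      ∀ i, Tendsto (fun k => y k i) atTop (𝓝 ys) := by
  obtain ⟨hγ0, -, hanti, hdiv, hsq⟩ := hγ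
  have hxs := hs.1
  have hys := hs.2.1
  have huY : ∀ k, T ≤ k → ∀ i, u k i ∈ Y := fun k hk i => by
    obtain ⟨s, p, hs1, -, -, hp, hp1, h⟩ := hu k hk i
    exact h ▸ sum_smul_mem hY hp hp1 (hy.mem hs1)
  have hvX : ∀ k, T ≤ k → ∀ i, v k i ∈ X := fun k hk i => by
    obtain ⟨s, p, hs1, -, -, hp, hp1, h⟩ := hv k hk i
    exact h ▸ sum_smul_mem hX hp hp1 (hx.mem hs1)
  obtain ⟨Cx, hCx0, hCx⟩ := hx.exists_norm_sub_le hX hA₁ hφ₁ hγ0 hLf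
    (eventually_atTop.2 ⟨T, huY⟩)
  obtain ⟨Cy, hCy0, hCy⟩ := hy.exists_norm_sub_le hY hA₂ hφ₂ hγ0 hLg
    (eventually_atTop.2 ⟨T, hvX⟩)
  have hsx := summable_mul_spread hA₁ hφ₁.pos hc₁ hB₁ (fun k => (hγ0 k).le) hanti hsq hCx0 hCx
  have hsy := summable_mul_spread hA₂ hφ₂.pos hc₂ hB₂ (fun k => (hγ0 k).le) hanti hsq hCy0 hCy
  set δx : ℕ → ℝ := fun k =>
    ∑ t ∈ Finset.range (T + 1), (spread (x (k - t)) + Cx * γ (k - t)) with hδx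
  set δy : ℕ → ℝ := fun k =>
    ∑ t ∈ Finset.range (T + 1), (spread (y (k - t)) + Cy * γ (k - t)) with hδy
  have hδx0 : ∀ k, 0 ≤ δx k := fun k => Finset.sum_nonneg fun t _ =>
    add_nonneg (spread_nonneg _) (mul_nonneg hCx0 (hγ0 _).le)
  have hδy0 : ∀ k, 0 ≤ δy k := fun k => Finset.sum_nonneg fun t _ =>
    add_nonneg (spread_nonneg _) (mul_nonneg hCy0 (hγ0 _).le)
  have hsδx : Summable fun k => γ k * δx k :=
    summable_mul_delayed_error hγ0 hanti hsq (fun k => spread_nonneg _) hsx hCx0 (T + 1)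
  have hsδy : Summable fun k => γ k * δy k :=
    summable_mul_delayed_error hγ0 hanti hsq (fun k => spread_nonneg _) hsy hCy0 (T + 1)
  have hxmX : ∀ᶠ k in atTop, ∑ i, φ₁ k i • x k i ∈ X := by
    filter_upwards [eventually_ge_atTop 1] with k hk
    exact sum_smul_mem hX (hφ₁.nonneg k) (hφ₁.sum_eq_one k) (hx.mem hk)
  have hymY : ∀ᶠ k in atTop, ∑ i, φ₂ k i • y k i ∈ Y := by
    filter_upwards [eventually_ge_atTop 1] with k hk
    exact sum_smul_mem hY (hφ₂.nonneg k) (hφ₂.sum_eq_one k) (hy.mem hk)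
  -- The sum of the `f i` is Lipschitz in `y` with constant `n₂ * L`, because it is minus the sum of
  -- the `n₂` functions `g i`, whose `y`-subgradients are bounded.
  obtain ⟨C₁, hC₁0, hdx⟩ := hx.exists_descent (L' := n₂ * L) hX hY hf hA₁ hφ₁ hγ0 hL0 hLf
    (by positivity)
    (fun x hx y hy y' hy' => by
      have := sum_sub_sum_le_of_convexSubdiff_bounded hg hLg hx hy' y
      rw [norm_sub_rev] at this
      rw [hfg x hx y hy, hfg x hx y' hy']
      linarith)
    (v := fun k => ∑ i, φ₂ k i • y k i) (δ := δy)
    (by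
      filter_upwards [hymY, eventually_ge_atTop T] with k hk hkT
      refine ⟨hk, fun i => ⟨huY k hkT i, ?_⟩⟩
      obtain ⟨s, p, -, hsk, hkT', hp, hp1, h⟩ := hu k hkT i
      rw [h]
      exact norm_delayed_sub_mean_le hφ₂ hCy0 hγ0 hCy hp hp1 hsk hkT') hδy0 hxs hys
  obtain ⟨C₂, hC₂0, hdy⟩ := hy.exists_descent (L' := n₁ * L) hY hX hg hA₂ hφ₂ hγ0 hL0 hLg
    (by positivity)
    (fun y hy x hx x' hx' => by
      have := sum_sub_sum_le_of_convexSubdiff_bounded hf hLf hy hx' x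
      rw [norm_sub_rev, hfg x hx y hy, hfg x' hx' y hy] at this
      linarith)
    (v := fun k => ∑ i, φ₁ k i • x k i) (δ := δx)
    (by
      filter_upwards [hxmX, eventually_ge_atTop T] with k hk hkT
      refine ⟨hk, fun i => ⟨hvX k hkT i, ?_⟩⟩
      obtain ⟨s, p, -, hsk, hkT', hp, hp1, h⟩ := hv k hkT i
      rw [h]
      exact norm_delayed_sub_mean_le hφ₁ hCx0 hγ0 hCx hp hp1 hsk hkT') hδx0 hys hxs
  set xm : ℕ → RVec m₁ := fun k => ∑ i, φ₁ k i • x k i with hxm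
  set ym : ℕ → RVec m₂ := fun k => ∑ i, φ₂ k i • y k i with hym
  set e : ℕ → ℝ := fun k => (spread (x k) + spread (y k)) + (δx k + δy k) with he
  set V : ℕ → ℝ := fun k =>
    ∑ i, φ₁ k i * ‖x k i - xs‖ ^ 2 + ∑ i, φ₂ k i * ‖y k i - ys‖ ^ 2 with hV
  set gap : ℕ → ℝ := fun k => ∑ i, f i (xm k) ys - ∑ i, f i xs (ym k) with hgap
  have hVx0 : ∀ k, 0 ≤ ∑ i, φ₁ k i * ‖x k i - xs‖ ^ 2 := fun k =>
    Finset.sum_nonneg fun i _ => mul_nonneg (hφ₁.nonneg k i) (sq_nonneg _)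
  have hVy0 : ∀ k, 0 ≤ ∑ i, φ₂ k i * ‖y k i - ys‖ ^ 2 := fun k =>
    Finset.sum_nonneg fun i _ => mul_nonneg (hφ₂.nonneg k i) (sq_nonneg _)
  have he0 : ∀ k, 0 ≤ e k := fun k =>
    add_nonneg (add_nonneg (spread_nonneg _) (spread_nonneg _)) (add_nonneg (hδx0 k) (hδy0 k))
  have hse : Summable fun k => γ k * e k :=
    ((hsx.add hsy).add (hsδx.add hsδy)).congr fun k => by simp only [he]; ring
  have hgap0 : ∀ᶠ k in atTop, 0 ≤ gap k := by
    filter_upwards [hxmX, hymY] with k hxk hyk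
    have h1 := (hs.2.2 _ hxk ys hys).2
    have h2 := (hs.2.2 xs hxs _ hyk).1
    simp only [hgap]
    linarith
  have hdesc : ∀ᶠ k in atTop, V (k + 1) ≤ V k - 2 * γ k * gap k +
      2 * (C₁ + C₂) * (γ k * e k) * (1 + V k) + 2 * (C₁ + C₂) * γ k ^ 2 := by
    filter_upwards [hdx, hdy, hxmX, hymY] with k h1 h2 hxk hyk
    rw [hfg _ hxk _ hyk, hfg xs hxs _ hyk] at h1
    -- Both gap terms are written through `g`, so that the values at `(xm k, ym k)` in the two
    -- descent inequalities cancel on addition.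
    have hgapk : gap k = -∑ i, g i ys (xm k) + ∑ i, g i (ym k) xs := by
      simp only [hgap]
      rw [hfg _ hxk _ hys, hfg xs hxs _ hyk]
      ring
    -- By Jensen the squared distances of the means are at most the two parts of `V k`. The factor
    -- `2` here is the one in `2 * (C₁ + C₂)`.
    have hW : (1 + ‖xm k - xs‖) * (1 + ‖ym k - ys‖) ≤ 2 * (1 + V k) :=
      one_add_mul_one_add_le (add_le_add
        (norm_sum_smul_sub_sq_le (hφ₁.nonneg k) (hφ₁.sum_eq_one k) (x k) xs)
        (norm_sum_smul_sub_sq_le (hφ₂.nonneg k) (hφ₂.sum_eq_one k) (y k) ys))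
    rw [mul_comm (1 + ‖ym k - ys‖)] at h2
    set W := (1 + ‖xm k - xs‖) * (1 + ‖ym k - ys‖) with hWdef
    have hW0 : 0 ≤ W := by positivity
    have hγk := hγ0 k
    have hex : γ k * (spread (x k) + δy k) ≤ γ k * e k := by
      refine mul_le_mul_of_nonneg_left ?_ hγk.le
      simp only [he]
      linarith [spread_nonneg (y k), hδx0 k]
    have hey : γ k * (spread (y k) + δx k) ≤ γ k * e k := by
      refine mul_le_mul_of_nonneg_left ?_ hγk.le
      simp only [he]
      linarith [spread_nonneg (x k), hδy0 k]
    have hγe : 0 ≤ γ k * e k := mul_nonneg hγk.le (he0 k)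
    have h3 : C₁ * (γ k * (spread (x k) + δy k)) * W ≤ C₁ * (γ k * e k) * (2 * (1 + V k)) :=
      mul_le_mul (mul_le_mul_of_nonneg_left hex hC₁0) hW hW0 (mul_nonneg hC₁0 hγe)
    have h4 : C₂ * (γ k * (spread (y k) + δx k)) * W ≤ C₂ * (γ k * e k) * (2 * (1 + V k)) :=
      mul_le_mul (mul_le_mul_of_nonneg_left hey hC₂0) hW hW0 (mul_nonneg hC₂0 hγe)
    have h5 : 0 ≤ (C₁ + C₂) * γ k ^ 2 := by positivity
    rw [hgapk]
    simp only [hV] at h3 h4 ⊢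
    linarith
  obtain ⟨⟨l, hl⟩, hfreq⟩ := tendsto_and_frequently_of_descent
    (fun k => add_nonneg (hVx0 k) (hVy0 k)) hγ0 (by positivity) he0 hdiv hsq hse hgap0 hdesc
  refine tendsto_saddlePoint hXc hYc hU (fun y => continuous_finsetSum _ fun i _ =>
    (hf i).continuous_left y) (fun x => continuous_finsetSum _ fun i _ => (hf i).continuous_right x)
    hs hφ₁.pos hφ₂.pos hφ₁.le hφ₂.le hφ₁.sum_eq_one hφ₂.sum_eq_one hxmX hymY hl fun ε hε => ?_
  refine (hfreq ε hε).mono fun k hk => lt_of_le_of_lt ?_ hk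
  simp only [he, hgap]
  linarith [hδx0 k, hδy0 k]

theorem theorem4 {n₁ n₂ m₁ m₂ : ℕ} (hn₁ : 0 < n₁) (hn₂ : 0 < n₂)
    (X : Set (RVec m₁)) (Y : Set (RVec m₂))
    (hXclosed : IsClosed X) (hXconvex : Convex ℝ X)
    (hYclosed : IsClosed Y) (hYconvex : Convex ℝ Y)
    (f : Fin n₁ → RVec m₁ → RVec m₂ → ℝ) (g : Fin n₂ → RVec m₁ → RVec m₂ → ℝ)
    (hf : ∀ i, ConvexConcave (f i)) (hg : ∀ i, ConvexConcave (g i))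
    (hfg : ∀ x ∈ X, ∀ y ∈ Y, ∑ i, f i x y = ∑ i, g i x y)
    (hA1 : SaddleExistence X Y f)
    (hA4 : BoundedSubgradients X Y f g)
    (hU : StrictConvexConcaveOn X Y (fun x y => ∑ i, f i x y))
    (N : CommNetwork n₁ n₂) (hA2 : N.Connectivity) (hA3 : N.WeightRule) :
    (∃ (α : ℕ → Fin n₁ → ℝ) (β : ℕ → Fin n₂ → ℝ),
      (∀ k i, 0 < α k i) ∧ (∀ k i, 0 < β k i) ∧ AchievesNash N X Y f g α β) ∧
    (∃ (φ₁ : ℕ → Fin n₁ → ℝ) (φ₂ : ℕ → Fin n₂ → ℝ),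
      (∀ s, IsLimitVector N.A₁ s (φ₁ s)) ∧ (∀ s, IsLimitVector N.A₂ s (φ₂ s)) ∧
      ∀ γ : ℕ → ℝ, BaseStepsize γ →
        AchievesNash N X Y f g
          (fun k i => γ k / φ₁ (k + 1) i) (fun k i => γ k / φ₂ (k + 1) i)) := by
  obtain ⟨⟨T, -, hbip⟩, hS₁, hS₂⟩ := hA2
  obtain ⟨⟨η, hη0, hη1, hη⟩, ⟨hr₁, hr₂⟩, hC₁, hC₂⟩ := hA3
  obtain ⟨L, hL0, hL⟩ := hA4
  have hA₁ : ∀ k, IsRowStochastic (N.A₁ k) := fun k => ⟨fun i j => N.weight_nonneg k _ _, hr₁ k⟩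
  have hA₂ : ∀ k, IsRowStochastic (N.A₂ k) := fun k => ⟨fun i j => N.weight_nonneg k _ _, hr₂ k⟩
  obtain ⟨φ₁, c₁, B₁, hc₁, hB₁, hφ₁, hlim₁⟩ := hS₁.exists_isLimitFamily hn₁ hA₁ hη0 hη1.le
    (fun k i => hη k _ _ (N.self_loop k (Sum.inl i))) fun k i j h => hη k _ _ h
  obtain ⟨φ₂, c₂, B₂, hc₂, hB₂, hφ₂, hlim₂⟩ := hS₂.exists_isLimitFamily hn₂ hA₂ hη0 hη1.le
    (fun k i => hη k _ _ (N.self_loop k (Sum.inr i))) fun k i j h => hη k _ _ h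
  obtain ⟨xs, ys, hs⟩ := isSaddlePoint_sum_of_saddleExistence hn₁ hA1
  have hcon₁ : ∀ k i, ∃ s, k ≤ s ∧ s < k + T ∧ N.Contact₁ s i := fun k i => by
    obtain ⟨j, s, h1, h2, -, h3⟩ := (hbip k).2.1 i
    exact ⟨s, h1, h2, j, h3⟩
  have hcon₂ : ∀ k i, ∃ s, k ≤ s ∧ s < k + T ∧ N.Contact₂ s i := fun k i => by
    obtain ⟨j, s, h1, h2, -, h3⟩ := (hbip k).2.2 i
    exact ⟨s, h1, h2, j, h3⟩
  have hmain : ∀ γ : ℕ → ℝ, BaseStepsize γ → AchievesNash N X Y f g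
      (fun k i => γ k / φ₁ (k + 1) i) (fun k i => γ k / φ₂ (k + 1) i) := by
    rintro γ hγ x y ⟨xb, yb, hxb, hyb, hx, hy⟩
    refine ⟨xs, ys, hs, ?_⟩
    -- Ascent of `y` on the concave `g j x` is descent on `-g j x`; supergradients become negatives
    -- of subgradients.
    refine tendsto_saddlePoint_of_iterations (g := fun j y x => -g j x y)
      hXclosed hXconvex hYclosed hYconvex hf (fun j => (hg j).neg_swap)
      (fun x hx y hy => by rw [hfg x hx y hy, Finset.sum_neg_distrib, neg_neg]) hL0.le
      (fun x hx y hy => (hL x hx y hy).1) (fun y hy x hx i q hq => ?_) hU hs hA₁ hA₂ hφ₁ hφ₂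
      hc₁ hc₂ hB₁ hB₂ hγ hx (fun k i => ?_) (T := T)
      (fun k hk i => exists_recent_average (fun k i j => N.weight_nonneg k _ _) hC₁ hcon₁ hxb hk i)
      (fun k hk i => exists_recent_average (fun k i j => N.weight_nonneg k _ _) hC₂ hcon₂ hyb hk i)
    · rw [← norm_neg]
      exact (hL x hx y hy).2 i (-q) (mem_concaveSubdiff_iff_neg.2 (by rwa [neg_neg]))
    · obtain ⟨q, hq, hp⟩ := hy k i
      exact ⟨-q, mem_concaveSubdiff_iff_neg.1 hq, by rwa [smul_neg, sub_neg_eq_add]⟩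
  -- Existence of stepsizes is witnessed by `γ k = 1 / (k + 1)`.
  refine ⟨⟨_, _, fun k i => ?_, fun k i => ?_, hmain _ baseStepsize_one_div⟩,
    φ₁, φ₂, hlim₁, hlim₂, hmain⟩
  · exact div_pos (baseStepsize_one_div.1 k) ((hlim₁ (k + 1)).1 i)
  · exact div_pos (baseStepsize_one_div.1 k) ((hlim₂ (k + 1)).1 i)
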